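/- Let $e_m(x)=\sqrt2\sin(m\pi x)$, $m\ge1$, be the Dirichlet eigenbasis of $\Delta$ on $(0,1)$, $(u,v)=\int_0^1u\bar v\,dx$, $\alpha>0$, $\lambda_m=\mathbf i(m\pi)^2+\alpha$, and $\|u\|_1^2=\sum_{m}|(u,e_m)|^2|\lambda_m|$; let $\dot H^1$ be the space of $u\in L^2(0,1;\mathbb C)$ with $\|u\|_1<\infty$. Let $V_N=\mathrm{span}_{\mathbb C}\{e_1,\dots,e_N\}$ and let $\pi_N u=\sum_{m=1}^N(u,e_m)e_m$. Let $Q$ be the operator with $Qe_m=\eta_me_m$, where $\eta_m\ge0$ and $\sum_m\eta_m<\infty$, and let $\pi_NQ^{1/2}W(t)=\sum_{m=1}^N\sqrt{\eta_m}\,\beta_m(t)e_m$, where $(\beta_m)_{m\ge1}$ are independent $\mathbb C$-valued Wiener processes with respect to a filtration $(\mathcal F_t)_{t\ge0}$, whose real and imaginary parts are independent standard real Brownian motions. For a time step $\tau>0$ with $\alpha\tau\le1$, put $t_k=k\tau$, $\delta W_k=W(t_k)-W(t_{k-1})$, and let $(u_N^k)_{k\ge0}$ be a $V_N$-valued, $(\mathcal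 F_{t_k})$-adapted solution of $$u_N^k-e^{-\alpha\tau}u_N^{k-1}=\Big(\mathbf i\Delta u_N^k+\mathbf i\lambda\pi_N\Big(\tfrac{|u_N^k|^2+|e^{-\alpha\tau}u_N^{k-1}|^2}{2}u_N^k\Big)\Big)\tau+\pi_NQ^{1/2}\delta W_k,\qquad u_N^0=\pi_Nu_0 .$$ Assume that $\lambda\in\{0,-1\}$, that $u_0\in\dot H^1$ is deterministic, and that $\|Q^{1/2}\|_{\mathcal{HS}(L^2,\dot H^1)}^2=\sum_m\|Q^{1/2}e_m\|_1^2<\infty$. Then for every real $p\ge1$ there is a constant $C$, depending only on $\alpha$, $Q$, $u_0$ and $p$ (in particular not on $N$, $k$ or $\tau$), such that $$E\,\mathcal H_k^p\le C\quad\text{for all }k\in\mathbb N,\qquad \mathcal H_k:=\|\nabla u_N^k\|_{L^2}^2-\tfrac{\lambda}{2}\|u_N^k\|_{L^4}^4 .$$ -/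

import Mathlib

open MeasureTheory ProbabilityTheory
open scoped NNReal ENNReal

namespace DampedNLS

noncomputable section

/-- The `n`-th Dirichlet eigenfunction `√2 sin((n+1)πx)` of the Laplacian on `(0,1)`. Modes are
numbered from `0`, so that `e 0, …, e (N-1)` are the first `N` of them. -/
def e (n : ℕ) (x : ℝ) : ℂ := ((√2 * Real.sin ((n + 1) * Real.pi * x) : ℝ) : ℂ)

/-- The inner product `(u,v) = ∫₀¹ u(x) conj(v(x)) dx` of `L²(0,1)`. -/
def ip (u v : ℝ → ℂ) : ℂ := ∫ x in (0 : ℝ)..1, u x * starRingEnd ℂ (v x)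

/-- The eigenvalues `i((n+1)π)² + α` of `A = -iΔ + α`. -/
def eigA (α : ℝ) (n : ℕ) : ℂ := Complex.I * (((n + 1) * Real.pi : ℝ) : ℂ) ^ 2 + (α : ℂ)

/-- The square of the `s`-norm, `‖u‖ₛ² = ∑ₙ |(u,eₙ)|² |λₙ|ˢ`, with values in `[0,∞]`. -/
def sobNormSq (α : ℝ) (s : ℕ) (u : ℝ → ℂ) : ℝ≥0∞ :=
  ∑' n : ℕ, ENNReal.ofReal (‖ip u (e n)‖ ^ 2 * ‖eigA α n‖ ^ s)

/-- Membership in `Ḣˢ`: `u ∈ L²(0,1)` with finite `s`-norm. -/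
def MemH (α : ℝ) (s : ℕ) (u : ℝ → ℂ) : Prop :=
  MemLp u 2 (volume.restrict (Set.Ioo (0 : ℝ) 1)) ∧ sobNormSq α s u < ∞

/-- The square root of the covariance operator with eigenpairs `(ηₘ, eₘ)`:
`Q^{1/2} f = ∑ₘ √ηₘ (f,eₘ) eₘ`. -/
def sqrtQ (η : ℕ → ℝ) (f : ℝ → ℂ) (x : ℝ) : ℂ :=
  ∑' m : ℕ, (√(η m) : ℂ) * ip f (e m) * e m x

/-- The square of the Hilbert–Schmidt norm of `Q^{1/2}` from `L²` to `Ḣˢ`: `∑ₘ ‖Q^{1/2} eₘ‖ₛ²`. -/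
def hsNormSq (α : ℝ) (s : ℕ) (η : ℕ → ℝ) : ℝ≥0∞ :=
  ∑' m : ℕ, sobNormSq α s (sqrtQ η (e m))

/-- The spectral Galerkin space `V_N`, the complex span of the first `N` eigenfunctions. -/
def V (N : ℕ) : Submodule ℂ (ℝ → ℂ) := Submodule.span ℂ (e '' Set.Iio N)

/-- The projection `π_N f = ∑_{m<N} (f,eₘ) eₘ` onto `V_N`. -/
def proj (N : ℕ) (f : ℝ → ℂ) (x : ℝ) : ℂ := ∑ m ∈ Finset.range N, ip f (e m) * e m x

/-- The discrete energy `‖∇u‖₀² - (lam/2) ‖u‖_{L⁴}⁴` (used for `u ∈ V_N`, which is smooth). -/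
def energy (lam : ℝ) (u : ℝ → ℂ) : ℝ :=
  (∫ x in (0 : ℝ)..1, ‖deriv u x‖ ^ 2) - lam / 2 * ∫ x in (0 : ℝ)..1, ‖u x‖ ^ 4

variable {Ω : Type*} {mΩ : MeasurableSpace Ω}

/-- Real part (`i.2 = false`) or imaginary part (`i.2 = true`) of the `i.1`-th process. -/
def part (β : ℕ → ℝ≥0 → Ω → ℂ) (i : ℕ × Bool) (t : ℝ≥0) (ω : Ω) : ℝ :=
  if i.2 then (β i.1 t ω).im else (β i.1 t ω).re

/-- The coordinates `βₘ` of a cylindrical Wiener process with respect to the filtration `ℱ`: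
independent `ℂ`-valued Wiener processes (real and imaginary parts are independent real Brownian
motions), adapted to `ℱ`, whose increments after time `s` are jointly independent of `ℱ s`. -/
structure IsCylindricalWiener (β : ℕ → ℝ≥0 → Ω → ℂ) (ℱ : Filtration ℝ≥0 mΩ) (P : Measure Ω) :
    Prop where
  brownian : ∀ i, IsBrownianReal (part β i) P
  indep : iIndepFun (fun i ω t ↦ part β i t ω) P
  adapted : ∀ m t, Measurable[ℱ t] (β m t)
  indep_increment : ∀ s t, s ≤ t →
    Indep (MeasurableSpace.comap (fun ω m ↦ β m t ω - β m s ω) MeasurableSpace.pi) (ℱ s) P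

/-- The projected noise increment `π_N Q^{1/2} (W(t) - W(s)) = ∑_{m<N} √ηₘ (βₘ(t) - βₘ(s)) eₘ`. -/
def noiseIncr (η : ℕ → ℝ) (β : ℕ → ℝ≥0 → Ω → ℂ) (N : ℕ) (s t : ℝ≥0) (ω : Ω) (x : ℝ) : ℂ :=
  ∑ m ∈ Finset.range N, (√(η m) : ℂ) * (β m t ω - β m s ω) * e m x

/-- One step of the modified implicit Euler scheme, from `v = u_N^{k-1}` to `u = u_N^k`, with step
`τ` and noise increment `δ`, as an equality of functions on `[0,1]`. -/
def SchemeStep (α lam : ℝ) (τ : ℝ≥0) (N : ℕ) (v u δ : ℝ → ℂ) : Prop :=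
  ∀ x ∈ Set.Icc (0 : ℝ) 1,
    u x - (Real.exp (-α * τ) : ℂ) * v x =
      (Complex.I * iteratedDeriv 2 u x +
        Complex.I * (lam : ℂ) * proj N (fun y ↦
          (((‖u y‖ ^ 2 + ‖(Real.exp (-α * τ) : ℂ) * v y‖ ^ 2) / 2 : ℝ) : ℂ) * u y) x) *
        ((τ : ℝ) : ℂ) + δ x

/-- `u k ω = u_N^k(ω)` is a `V_N`-valued solution, adapted to `(ℱ_{t_k})` with `t_k = kτ`, of the
fully discrete scheme started at `π_N u₀`. Measurability with respect to the Borel `σ`-algebra of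
the finite-dimensional space `V_N` is measurability of the coordinates `(u_N^k, eₘ)`. -/
structure IsSchemeSolution (α lam : ℝ) (η : ℕ → ℝ) (u₀ : ℝ → ℂ) (τ : ℝ≥0) (N : ℕ)
    (β : ℕ → ℝ≥0 → Ω → ℂ) (ℱ : Filtration ℝ≥0 mΩ) (P : Measure Ω) (u : ℕ → Ω → ℝ → ℂ) :
    Prop where
  mem : ∀ k ω, u k ω ∈ V N
  adapted : ∀ k m : ℕ, Measurable[ℱ (k * τ)] (fun ω ↦ ip (u k ω) (e m))
  init : ∀ᵐ ω ∂P, u 0 ω = proj N u₀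
  step : ∀ k : ℕ, ∀ᵐ ω ∂P, SchemeStep α lam τ N (u k ω) (u (k + 1) ω)
    (noiseIncr η β N (k * τ) ((k + 1) * τ) ω)

end

end DampedNLS

/-! Put `lam = -l` with `l = 0` or `1`, so the energy `H` is nonnegative. In one step let `w` be the
damped previous value, `δ` the noise increment, `Y = ‖∇δ‖²` and `s = √(1 + H(w))`.

The nonlinearity is discretised so that the residual `u - w - δ` equals `iτ` times a discrete
variational derivative of the energy, hence is orthogonal to it in the real sense. Expanding `H(u)`
around `w` therefore leaves only `H(w)`, a term `M` linear in `δ`, and a remainder bounded by `s(25Y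
+ 8Y²)` (`DampedStep.energy_le`, `mul_massSq_le`).

The decisive gain is in the growth: because `H` controls the `L⁴` norm, the mass is of order `s`,
and `M² ≤ 40 s³ Y` rather than `s⁴ Y` (`energyDeriv_sq_le`). So in the expansion of `(1 + H)^(2r+2)
= s^(4r+4)` every term other than the leading one and the one linear in `M` is of order `s^(4r+3)`
(`power_step_le`). Young's inequality turns this into an arbitrarily small multiple of `s^(4r+4)`
plus a constant, so the damping wins with no smallness of the noise.

In expectation the linear term vanishes, since the increment is independent of the past and centred
(`IsCylindricalWiener.integral_mul_energyDeriv`). The moments of `Y` are at most a constant times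
`τ`, the constant involving the modes only through `∑ ηₘ((m+1)π)²`
(`IsCylindricalWiener.gradSq_pow`), which gives uniformity in `N`. Damping contracts the power
moment by `1 - θ`, `θ = ατ/2`, up to an additive `θ`. Gain and loss are both proportional to `τ`, so
a bound independent of `τ` propagates from step to step (`contraction_le`). -/

namespace DampedNLS

noncomputable section

/-! ### Sine modes and the Galerkin space in coordinates -/

/-- The wave number `(n+1)π` of the `n`-th mode. -/
def freq (n : ℕ) : ℝ := (n + 1) * Real.pi

lemma freq_pos (n : ℕ) : 0 < freq n := by unfold freq; positivity

/-- The derivative of the `n`-th eigenfunction. -/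
def eDeriv (n : ℕ) (x : ℝ) : ℂ := ((√2 * (freq n * Real.cos (freq n * x)) : ℝ) : ℂ)

/-- The trigonometric sum with coefficients `c`. -/
def sinSum (N : ℕ) (c : ℕ → ℂ) (x : ℝ) : ℂ := ∑ m ∈ Finset.range N, c m * e m x

lemma hasDerivAt_e (n : ℕ) (x : ℝ) : HasDerivAt (e n) (eDeriv n x) x := by
  have h : HasDerivAt (fun x : ℝ => √2 * Real.sin (freq n * x))
      (√2 * (freq n * Real.cos (freq n * x))) x := by
    have := (((hasDerivAt_id x).const_mul (freq n)).sin).const_mul (√2)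
    rw [mul_one, mul_comm (Real.cos _)] at this
    exact this
  exact h.ofReal_comp

lemma hasDerivAt_eDeriv (n : ℕ) (x : ℝ) :
    HasDerivAt (eDeriv n) (-((freq n : ℂ) ^ 2) * e n x) x := by
  have h : HasDerivAt (fun x : ℝ => √2 * (freq n * Real.cos (freq n * x)))
      (-(freq n ^ 2) * (√2 * Real.sin (freq n * x))) x := by
    have := ((((hasDerivAt_id x).const_mul (freq n)).cos).const_mul (freq n)).const_mul (√2)
    rw [show -(freq n ^ 2) * (√2 * Real.sin (freq n * x))
      = √2 * (freq n * (-Real.sin (freq n * id x) * (freq n * 1))) by simp only [id]; ring]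
    exact this
  have := h.ofReal_comp
  unfold e
  rw [show -((freq n : ℂ) ^ 2) * ((√2 * Real.sin ((n + 1) * Real.pi * x) : ℝ) : ℂ)
    = ((-(freq n ^ 2) * (√2 * Real.sin (freq n * x)) : ℝ) : ℂ) by push_cast [freq]; ring]
  exact this

lemma deriv_e (n : ℕ) : deriv (e n) = eDeriv n := funext fun x => (hasDerivAt_e n x).deriv

lemma deriv_eDeriv (n : ℕ) : deriv (eDeriv n) = fun x => -((freq n : ℂ) ^ 2) * e n x :=
  funext fun x => (hasDerivAt_eDeriv n x).deriv

lemma contDiff_e (n : ℕ) : ContDiff ℝ 2 (e n) := by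
  have h : ContDiff ℝ 2 (fun x : ℝ => √2 * Real.sin (freq n * x)) := by fun_prop
  exact Complex.ofRealCLM.contDiff.comp h

lemma continuous_e (n : ℕ) : Continuous (e n) := (contDiff_e n).continuous

lemma continuous_eDeriv (n : ℕ) : Continuous (eDeriv n) := by
  unfold eDeriv; fun_prop

lemma e_zero (n : ℕ) : e n 0 = 0 := by simp [e]

lemma e_one (n : ℕ) : e n 1 = 0 := by
  have := Real.sin_nat_mul_pi (n + 1)
  push_cast at this
  simp [e, this]

lemma mem_V_iff {N : ℕ} {u : ℝ → ℂ} : u ∈ V N ↔ ∃ c, u = sinSum N c := by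
  constructor
  · intro h
    induction h using Submodule.span_induction with
    | mem x hx =>
      obtain ⟨m, hm, rfl⟩ := hx
      refine ⟨Pi.single m 1, ?_⟩
      ext x
      rw [sinSum, Finset.sum_eq_single_of_mem m (Finset.mem_range.2 hm)]
      · simp
      · intro b _ hb; simp [hb]
    | zero => exact ⟨0, by ext; simp [sinSum]⟩
    | add x y _ _ hx hy =>
      obtain ⟨c, rfl⟩ := hx
      obtain ⟨d, rfl⟩ := hy
      exact ⟨c + d, by ext; simp [sinSum, add_mul, Finset.sum_add_distrib]⟩
    | smul a x _ hx =>
      obtain ⟨c, rfl⟩ := hx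
      exact ⟨a • c, by ext; simp [sinSum, Finset.mul_sum, mul_assoc]⟩
  · rintro ⟨c, rfl⟩
    have : sinSum N c = ∑ m ∈ Finset.range N, c m • e m := by ext; simp [sinSum]
    rw [this]
    exact Submodule.sum_mem _ fun m hm => Submodule.smul_mem _ _
      (Submodule.subset_span ⟨m, Finset.mem_range.1 hm, rfl⟩)

lemma sinSum_mem_V (N : ℕ) (c : ℕ → ℂ) : sinSum N c ∈ V N := mem_V_iff.2 ⟨c, rfl⟩

lemma hasDerivAt_sinSum (N : ℕ) (c : ℕ → ℂ) (x : ℝ) :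
    HasDerivAt (sinSum N c) (∑ m ∈ Finset.range N, c m * eDeriv m x) x := by
  unfold sinSum
  exact HasDerivAt.fun_sum fun m _ => (hasDerivAt_e m x).const_mul (c m)

lemma deriv_sinSum (N : ℕ) (c : ℕ → ℂ) :
    deriv (sinSum N c) = fun x => ∑ m ∈ Finset.range N, c m * eDeriv m x :=
  funext fun x => (hasDerivAt_sinSum N c x).deriv

lemma contDiff_of_mem_V {N : ℕ} {u : ℝ → ℂ} (hu : u ∈ V N) : ContDiff ℝ 2 u := by
  obtain ⟨c, rfl⟩ := mem_V_iff.1 hu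
  unfold sinSum
  exact ContDiff.sum fun m _ => contDiff_const.mul (contDiff_e m)

lemma continuous_of_mem_V {N : ℕ} {u : ℝ → ℂ} (hu : u ∈ V N) : Continuous u :=
  (contDiff_of_mem_V hu).continuous

lemma continuous_deriv_of_mem_V {N : ℕ} {u : ℝ → ℂ} (hu : u ∈ V N) : Continuous (deriv u) :=
  (contDiff_of_mem_V hu).continuous_deriv (by norm_num)

lemma differentiable_of_mem_V {N : ℕ} {u : ℝ → ℂ} (hu : u ∈ V N) : Differentiable ℝ u :=
  (contDiff_of_mem_V hu).differentiable (by norm_num)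

lemma apply_zero_of_mem_V {N : ℕ} {u : ℝ → ℂ} (hu : u ∈ V N) : u 0 = 0 := by
  obtain ⟨c, rfl⟩ := mem_V_iff.1 hu
  simp [sinSum, e_zero]

lemma apply_one_of_mem_V {N : ℕ} {u : ℝ → ℂ} (hu : u ∈ V N) : u 1 = 0 := by
  obtain ⟨c, rfl⟩ := mem_V_iff.1 hu
  simp [sinSum, e_one]

/-! ### The inner product on continuous functions -/

lemma ip_intervalIntegrable {u v : ℝ → ℂ} (hu : Continuous u) (hv : Continuous v) :
    IntervalIntegrable (fun x => u x * starRingEnd ℂ (v x)) volume 0 1 :=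
  (hu.mul (Complex.continuous_conj.comp hv)).intervalIntegrable _ _

lemma ip_sum_left {ι : Type*} (s : Finset ι) (c : ι → ℂ) (f : ι → ℝ → ℂ) {v : ℝ → ℂ}
    (hf : ∀ i, Continuous (f i)) (hv : Continuous v) :
    ip (fun x => ∑ i ∈ s, c i * f i x) v = ∑ i ∈ s, c i * ip (f i) v := by
  unfold ip
  simp_rw [Finset.sum_mul, mul_assoc]
  rw [intervalIntegral.integral_finsetSum]
  · simp
  · exact fun i _ => (ip_intervalIntegrable (hf i) hv).const_mul _

lemma ip_conj (u v : ℝ → ℂ) : starRingEnd ℂ (ip u v) = ip v u := by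
  unfold ip
  rw [intervalIntegral.integral_of_le zero_le_one, intervalIntegral.integral_of_le zero_le_one,
    ← integral_conj]
  simp [mul_comm]

lemma ip_sum_right {ι : Type*} (s : Finset ι) (c : ι → ℂ) (f : ι → ℝ → ℂ) {v : ℝ → ℂ}
    (hf : ∀ i, Continuous (f i)) (hv : Continuous v) :
    ip v (fun x => ∑ i ∈ s, c i * f i x) = ∑ i ∈ s, starRingEnd ℂ (c i) * ip v (f i) := by
  rw [← ip_conj, ip_sum_left s c f hf hv, map_sum]
  simp [ip_conj]

lemma re_ip {u v : ℝ → ℂ} (hu : Continuous u) (hv : Continuous v) :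
    (ip u v).re = ∫ x in (0 : ℝ)..1, (u x * starRingEnd ℂ (v x)).re := by
  have := Complex.reCLM.intervalIntegral_comp_comm (ip_intervalIntegrable hu hv)
  simpa [ip] using this.symm

lemma ip_deriv_deriv {u v : ℝ → ℂ} (hu : ContDiff ℝ 2 u) (hv : ContDiff ℝ 1 v)
    (h0 : v 0 = 0) (h1 : v 1 = 0) :
    ip (deriv (deriv u)) v = -ip (deriv u) (deriv v) := by
  have hu1 : ContDiff ℝ 1 (deriv u) := by
    have : ContDiff ℝ (1 + 1) u := by convert hu using 1; norm_num
    exact (contDiff_succ_iff_deriv.1 this).2.2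
  have hu2 : Continuous (deriv (deriv u)) := hu1.continuous_deriv le_rfl
  have hv2 : Continuous (deriv v) := hv.continuous_deriv le_rfl
  have := intervalIntegral.integral_deriv_mul_eq_sub (a := 0) (b := 1)
    (u := deriv u) (u' := deriv (deriv u))
    (v := fun x => starRingEnd ℂ (v x)) (v' := fun x => starRingEnd ℂ (deriv v x))
    (fun x _ => (hu1.differentiable one_ne_zero x).hasDerivAt)
    (fun x _ => ((hv.differentiable one_ne_zero x).hasDerivAt).star)
    (hu2.intervalIntegrable _ _) ((Complex.continuous_conj.comp hv2).intervalIntegrable _ _)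
  rw [intervalIntegral.integral_add (ip_intervalIntegrable hu2 hv.continuous)
    (ip_intervalIntegrable hu1.continuous hv2)] at this
  simp only [h0, h1, map_zero, mul_zero, sub_zero] at this
  exact eq_neg_of_add_eq_zero_left this

lemma ip_eDeriv (m n : ℕ) : ip (eDeriv m) (eDeriv n) = (freq m : ℂ) ^ 2 * ip (e m) (e n) := by
  have := ip_deriv_deriv (contDiff_e m) ((contDiff_e n).of_le (by norm_num)) (e_zero n) (e_one n)
  rw [deriv_e, deriv_e, deriv_eDeriv] at this
  rw [← neg_eq_iff_eq_neg.2 this]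
  simp [ip, mul_assoc]

lemma ip_e (m n : ℕ) : ip (e m) (e n) = if m = n then 1 else 0 := by
  split_ifs with h
  · subst h
    have hi : ∫ x in (0 : ℝ)..1, (√2 * Real.sin (freq m * x)) * (√2 * Real.sin (freq m * x)) = 1 := by
      have h2 : (√2 : ℝ) * √2 = 2 := Real.mul_self_sqrt (by norm_num)
      have : ∀ x, (√2 * Real.sin (freq m * x)) * (√2 * Real.sin (freq m * x))
          = 2 * (fun y => Real.sin y ^ 2) (freq m * x) := by
        intro x; linear_combination Real.sin (freq m * x) ^ 2 * h2
      simp_rw [this]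
      rw [intervalIntegral.integral_const_mul,
        intervalIntegral.integral_comp_mul_left (fun y => Real.sin y ^ 2) (freq_pos m).ne',
        integral_sin_sq]
      have hs : Real.sin (freq m) = 0 := by
        have := Real.sin_nat_mul_pi (m + 1)
        push_cast at this
        exact this
      have := (freq_pos m).ne'
      simp only [hs, Real.sin_zero, mul_zero, zero_mul, mul_one, sub_zero, zero_add, smul_eq_mul]
      field_simp
    unfold ip e
    simp_rw [Complex.conj_ofReal, ← Complex.ofReal_mul]
    rw [intervalIntegral.integral_ofReal]
    change ((∫ x in (0 : ℝ)..1, (√2 * Real.sin (freq m * x)) * (√2 * Real.sin (freq m * x)) : ℝ) : ℂ) = 1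
    rw [hi]; simp
  -- Integration by parts in either order gives the same pairing of derivatives, once with factor
  -- `freq m ^ 2` and once with `freq n ^ 2`; as these differ, the inner product is zero.
  · have h1 := ip_eDeriv m n
    have h2 := ip_eDeriv n m
    rw [← ip_conj, h1, ← ip_conj (e m)] at h2
    simp only [map_mul, map_pow, Complex.conj_ofReal] at h2
    rw [ip_conj] at h2
    have h3 : ((freq m : ℂ) ^ 2 - (freq n : ℂ) ^ 2) * ip (e n) (e m) = 0 := by
      linear_combination h2
    have h4 : ((freq m : ℂ) ^ 2 - (freq n : ℂ) ^ 2) ≠ 0 := by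
      rw [sub_ne_zero]
      norm_cast
      rw [sq_eq_sq₀ (freq_pos m).le (freq_pos n).le]
      simp only [freq]
      intro h5
      have := mul_right_cancel₀ Real.pi_ne_zero h5
      norm_cast at this
      omega
    rw [← ip_conj, (mul_eq_zero.1 h3).resolve_left h4, map_zero]

lemma ip_sinSum_e (N : ℕ) (c : ℕ → ℂ) (n : ℕ) :
    ip (sinSum N c) (e n) = if n < N then c n else 0 := by
  unfold sinSum
  rw [ip_sum_left _ _ _ continuous_e (continuous_e n)]
  simp [ip_e]

lemma sinSum_ip {N : ℕ} {u : ℝ → ℂ} (hu : u ∈ V N) : sinSum N (fun m => ip u (e m)) = u := by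
  obtain ⟨c, rfl⟩ := mem_V_iff.1 hu
  ext x
  refine Finset.sum_congr rfl fun m hm => ?_
  dsimp only
  rw [ip_sinSum_e, if_pos (Finset.mem_range.1 hm)]

lemma proj_mem_V (N : ℕ) (f : ℝ → ℂ) : proj N f ∈ V N := sinSum_mem_V N fun m => ip f (e m)

/-- Orthogonality of the projection: it disappears from the scheme once the equation is tested
within `V N`. -/
lemma ip_proj {N : ℕ} {f v : ℝ → ℂ} (hf : Continuous f) (hv : v ∈ V N) :
    ip (proj N f) v = ip f v := by
  obtain ⟨c, rfl⟩ := mem_V_iff.1 hv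
  unfold sinSum
  rw [ip_sum_right _ _ _ continuous_e (continuous_of_mem_V (proj_mem_V N f)),
    ip_sum_right _ _ _ continuous_e hf]
  refine Finset.sum_congr rfl fun m hm => ?_
  congr 1
  refine (ip_sinSum_e N (fun m => ip f (e m)) m).trans ?_
  rw [if_pos (Finset.mem_range.1 hm)]

/-! ### Norms on the Galerkin space -/

lemma integral_norm_deriv_sinSum_sq (N : ℕ) (c : ℕ → ℂ) :
    ∫ x in (0 : ℝ)..1, ‖deriv (sinSum N c) x‖ ^ 2
      = ∑ m ∈ Finset.range N, freq m ^ 2 * ‖c m‖ ^ 2 := by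
  have hc := continuous_deriv_of_mem_V (sinSum_mem_V N c)
  have h1 : ((∫ x in (0 : ℝ)..1, ‖deriv (sinSum N c) x‖ ^ 2 : ℝ) : ℂ)
      = ip (deriv (sinSum N c)) (deriv (sinSum N c)) := by
    rw [← intervalIntegral.integral_ofReal]
    simp [ip, Complex.mul_conj']
  have h2 : ip (deriv (sinSum N c)) (deriv (sinSum N c))
      = ((∑ m ∈ Finset.range N, freq m ^ 2 * ‖c m‖ ^ 2 : ℝ) : ℂ) := by
    nth_rw 2 [deriv_sinSum]
    rw [ip_sum_right _ _ _ continuous_eDeriv hc, deriv_sinSum]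
    push_cast
    refine Finset.sum_congr rfl fun m hm => ?_
    rw [ip_sum_left _ _ _ continuous_eDeriv (continuous_eDeriv m)]
    simp only [ip_eDeriv, ip_e]
    rw [Finset.sum_eq_single_of_mem m hm]
    · simp only [if_true, ← Complex.conj_mul']; ring
    · intro b _ hb; simp [hb]
  exact_mod_cast h1.trans h2

lemma sq_integral_mul_le {f g : ℝ → ℝ} (hf : Continuous f) (hg : Continuous g) :
    (∫ x in (0 : ℝ)..1, f x * g x) ^ 2
      ≤ (∫ x in (0 : ℝ)..1, f x ^ 2) * ∫ x in (0 : ℝ)..1, g x ^ 2 := by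
  have key : ∀ t : ℝ, 0 ≤ (∫ x in (0 : ℝ)..1, g x ^ 2) * (t * t)
      + (-2 * ∫ x in (0 : ℝ)..1, f x * g x) * t + ∫ x in (0 : ℝ)..1, f x ^ 2 := by
    intro t
    have h : ∫ x in (0 : ℝ)..1, (f x - t * g x) ^ 2
        = (∫ x in (0 : ℝ)..1, g x ^ 2) * (t * t)
      + (-2 * ∫ x in (0 : ℝ)..1, f x * g x) * t + ∫ x in (0 : ℝ)..1, f x ^ 2 := by
      rw [← intervalIntegral.integral_mul_const, ← intervalIntegral.integral_const_mul,
        ← intervalIntegral.integral_mul_const, ← intervalIntegral.integral_add,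
        ← intervalIntegral.integral_add]
      · congr 1; ext x; ring
      all_goals exact Continuous.intervalIntegrable (by fun_prop) _ _
    rw [← h]
    exact intervalIntegral.integral_nonneg zero_le_one fun x _ => sq_nonneg _
  have := discrim_le_zero key
  rw [discrim] at this
  nlinarith

lemma sq_integral_le {f : ℝ → ℝ} (hf : Continuous f) :
    (∫ x in (0 : ℝ)..1, f x) ^ 2 ≤ ∫ x in (0 : ℝ)..1, f x ^ 2 := by
  simpa using sq_integral_mul_le hf (continuous_const (y := (1 : ℝ)))

/-- One-dimensional Sobolev embedding: integrate the derivative from the boundary zero and apply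
Cauchy–Schwarz. The constant is free of `N`. -/
lemma norm_sq_le_of_mem_V {N : ℕ} {u : ℝ → ℂ} (hu : u ∈ V N) {x : ℝ} (hx : x ∈ Set.Icc (0 : ℝ) 1) :
    ‖u x‖ ^ 2 ≤ ∫ y in (0 : ℝ)..1, ‖deriv u y‖ ^ 2 := by
  have hc := continuous_deriv_of_mem_V hu
  have h1 : ∫ y in (0 : ℝ)..x, deriv u y = u x := by
    rw [intervalIntegral.integral_deriv_eq_sub (fun y _ => differentiable_of_mem_V hu y)
      (hc.intervalIntegrable _ _), apply_zero_of_mem_V hu, sub_zero]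
  have h2 : ‖u x‖ ≤ ∫ y in (0 : ℝ)..1, ‖deriv u y‖ := by
    rw [← h1]
    refine (intervalIntegral.norm_integral_le_integral_norm hx.1).trans ?_
    exact intervalIntegral.integral_mono_interval le_rfl hx.1 hx.2
      (Filter.Eventually.of_forall fun _ => norm_nonneg _) (hc.norm.intervalIntegrable _ _)
  exact (pow_le_pow_left₀ (norm_nonneg _) h2 2).trans (sq_integral_le hc.norm)

/-! ### The parts of the energy and its derivative -/

/-- `‖∇u‖₀²`. -/
def gradSq (u : ℝ → ℂ) : ℝ := ∫ x in (0 : ℝ)..1, ‖deriv u x‖ ^ 2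

/-- `‖u‖₀²`. -/
def massSq (u : ℝ → ℂ) : ℝ := ∫ x in (0 : ℝ)..1, ‖u x‖ ^ 2

/-- `‖u‖_{L⁴}⁴`. -/
def quartic (u : ℝ → ℂ) : ℝ := ∫ x in (0 : ℝ)..1, ‖u x‖ ^ 4

/-- The cubic nonlinearity `|w|² w`. -/
def cubic (w : ℝ → ℂ) (x : ℝ) : ℂ := ((‖w x‖ ^ 2 : ℝ) : ℂ) * w x

/-- The derivative of the energy (with `lam = -l`) at `w` in the direction `δ`. -/
def energyDeriv (l : ℝ) (w δ : ℝ → ℂ) : ℝ :=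
  2 * (ip (deriv w) (deriv δ)).re + 2 * l * (ip (cubic w) δ).re

lemma energy_neg (l : ℝ) (u : ℝ → ℂ) : energy (-l) u = gradSq u + l / 2 * quartic u := by
  unfold energy gradSq quartic; ring

lemma gradSq_nonneg (u : ℝ → ℂ) : 0 ≤ gradSq u :=
  intervalIntegral.integral_nonneg zero_le_one fun _ _ => by positivity

lemma quartic_nonneg (u : ℝ → ℂ) : 0 ≤ quartic u :=
  intervalIntegral.integral_nonneg zero_le_one fun _ _ => by positivity

lemma energy_neg_nonneg {l : ℝ} (hl : 0 ≤ l) (u : ℝ → ℂ) : 0 ≤ energy (-l) u := by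
  rw [energy_neg]
  have := gradSq_nonneg u
  have := quartic_nonneg u
  positivity

lemma continuous_cubic {w : ℝ → ℂ} (hw : Continuous w) : Continuous (cubic w) := by
  unfold cubic; fun_prop

lemma integral_mono_unit {f g : ℝ → ℝ} (hf : Continuous f) (hg : Continuous g)
    (h : ∀ x ∈ Set.Icc (0 : ℝ) 1, f x ≤ g x) :
    ∫ x in (0 : ℝ)..1, f x ≤ ∫ x in (0 : ℝ)..1, g x :=
  intervalIntegral.integral_mono_on zero_le_one (hf.intervalIntegrable _ _)
    (hg.intervalIntegrable _ _) h

/-! ### Pointwise inequalities behind the energy estimate -/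

/-- The difference of the two sides is exactly `‖u - w - d‖ ^ 2`. -/
lemma gradient_pointwise (u w d : ℂ) :
    ‖u‖ ^ 2 ≤ ‖w‖ ^ 2 + 2 * (w * starRingEnd ℂ d).re + ‖d‖ ^ 2
      + 2 * (u * starRingEnd ℂ (u - w - d)).re := by
  have h := sq_nonneg (u.re - w.re - d.re)
  have h' := sq_nonneg (u.im - w.im - d.im)
  simp only [← Complex.normSq_eq_norm_sq, Complex.normSq_apply, Complex.mul_re, Complex.conj_re,
    Complex.conj_im, Complex.sub_re, Complex.sub_im]
  nlinarith

lemma abs_re_mul_conj_le (z d : ℂ) : |(z * starRingEnd ℂ d).re| ≤ ‖z‖ * ‖d‖ := by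
  simpa using Complex.abs_re_le_norm (z * starRingEnd ℂ d)

/-- The weight `‖u‖² + ‖w‖²` turns `‖u‖² - ‖w‖²` into a difference of fourth powers, and
polarisation produces the spare square `‖u - w‖²`. The errors are at most `5/2 ‖u - w‖ ‖d‖` times
the weight; they are absorbed by that square and `4‖d‖²`, as `(5/2)² ≤ 4 · (1/2) · 4`. -/
lemma quartic_pointwise (u w d : ℂ) :
    1 / 2 * ‖u‖ ^ 4 ≤ 1 / 2 * ‖w‖ ^ 4 + 2 * (‖w‖ ^ 2 * (w * starRingEnd ℂ d).re)
      + 4 * ((‖u‖ ^ 2 + ‖w‖ ^ 2) * ‖d‖ ^ 2)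
      + (‖u‖ ^ 2 + ‖w‖ ^ 2) * (u * starRingEnd ℂ (u - w - d)).re := by
  have h1 : (u * starRingEnd ℂ (u - w - d)).re = 1 / 2 * (‖u‖ ^ 2 - ‖w‖ ^ 2 + ‖u - w‖ ^ 2)
      - ((u - w) * starRingEnd ℂ d).re - (w * starRingEnd ℂ d).re := by
    simp only [← Complex.normSq_eq_norm_sq, Complex.normSq_apply, Complex.mul_re, Complex.conj_re,
      Complex.conj_im, Complex.sub_re, Complex.sub_im]
    ring
  have h2 := (abs_le.1 (abs_re_mul_conj_le (u - w) d)).2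
  have h3 := abs_re_mul_conj_le w d
  have h4 : |‖u‖ ^ 2 - ‖w‖ ^ 2| ≤ ‖u - w‖ * (‖u‖ + ‖w‖) := by
    rw [sq_sub_sq, abs_mul, abs_of_nonneg (by positivity : 0 ≤ ‖u‖ + ‖w‖), mul_comm]
    exact mul_le_mul_of_nonneg_right (abs_norm_sub_norm_le u w) (by positivity)
  have h5 : (‖u‖ ^ 2 - ‖w‖ ^ 2) * (w * starRingEnd ℂ d).re
      ≤ (‖u - w‖ * (‖u‖ + ‖w‖)) * (‖w‖ * ‖d‖) :=
    (le_abs_self _).trans (by rw [abs_mul]; gcongr)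
  rw [h1]
  generalize (w * starRingEnd ℂ d).re = p at *
  generalize ((u - w) * starRingEnd ℂ d).re = q at *
  have ha := norm_nonneg u
  have hb := norm_nonneg w
  have hr := norm_nonneg (u - w)
  have hk := norm_nonneg d
  generalize ‖u‖ = a at *
  generalize ‖w‖ = b at *
  generalize ‖u - w‖ = r at *
  generalize ‖d‖ = k at *
  have h6 : (a ^ 2 + b ^ 2) * q ≤ (a ^ 2 + b ^ 2) * (r * k) := by gcongr
  have h7 : (a + b) * b * (r * k) ≤ 3 / 2 * (a ^ 2 + b ^ 2) * (r * k) := by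
    refine mul_le_mul_of_nonneg_right ?_ (by positivity)
    nlinarith [sq_nonneg (a - b), sq_nonneg a]
  have h8 : 0 ≤ (a ^ 2 + b ^ 2) * (1 / 2 * r ^ 2 + 4 * k ^ 2 - 5 / 2 * (r * k)) := by
    have : 0 ≤ 1 / 2 * r ^ 2 + 4 * k ^ 2 - 5 / 2 * (r * k) := by
      nlinarith [sq_nonneg (r - 5 / 2 * k), sq_nonneg k]
    positivity
  nlinarith

/-! ### Pathwise estimates for one step of the scheme -/

section Step

variable {N : ℕ} {lam τ : ℝ} {u w δ : ℝ → ℂ}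

/-- The symmetric nonlinearity of the scheme. -/
def schemeNonlin (u w : ℝ → ℂ) (y : ℝ) : ℂ := (((‖u y‖ ^ 2 + ‖w y‖ ^ 2) / 2 : ℝ) : ℂ) * u y

/-- The discrete variational derivative of the energy. -/
def schemeForce (lam : ℝ) (N : ℕ) (u w : ℝ → ℂ) (x : ℝ) : ℂ :=
  deriv (deriv u) x + (lam : ℂ) * proj N (schemeNonlin u w) x

/-- One step of the scheme in terms of the damped previous value `w`. -/
def DampedStep (lam τ : ℝ) (N : ℕ) (w u δ : ℝ → ℂ) : Prop :=
  ∀ x ∈ Set.Icc (0 : ℝ) 1,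
    u x - w x = (Complex.I * iteratedDeriv 2 u x +
        Complex.I * (lam : ℂ) * proj N (schemeNonlin u w) x) * (τ : ℂ) + δ x

lemma continuous_schemeNonlin (hu : Continuous u) (hw : Continuous w) :
    Continuous (schemeNonlin u w) := by
  unfold schemeNonlin; fun_prop

lemma ip_schemeForce (hu : u ∈ V N) (hw : w ∈ V N) {φ : ℝ → ℂ} (hφ : φ ∈ V N) :
    ip (schemeForce lam N u w) φ = -ip (deriv u) (deriv φ) + lam * ip (schemeNonlin u w) φ := by
  have hG := continuous_schemeNonlin (continuous_of_mem_V hu) (continuous_of_mem_V hw)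
  have h2 := continuous_of_mem_V (proj_mem_V N (schemeNonlin u w))
  have h3 := continuous_of_mem_V hφ
  have h1 : Continuous (deriv (deriv u)) := by
    have h : ContDiff ℝ (1 + 1) u := by
      convert contDiff_of_mem_V hu using 1; norm_num
    exact (contDiff_succ_iff_deriv.1 h).2.2.continuous_deriv le_rfl
  rw [← ip_deriv_deriv (contDiff_of_mem_V hu) ((contDiff_of_mem_V hφ).of_le (by norm_num))
    (apply_zero_of_mem_V hφ) (apply_one_of_mem_V hφ), ← ip_proj hG hφ]
  unfold ip schemeForce
  rw [← intervalIntegral.integral_const_mul, ← intervalIntegral.integral_add]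
  · congr 1; ext x; ring
  · exact ip_intervalIntegrable h1 h3
  · exact (ip_intervalIntegrable h2 h3).const_mul _

lemma DampedStep.residual_eq (h : DampedStep lam τ N w u δ) {x : ℝ} (hx : x ∈ Set.Icc (0 : ℝ) 1) :
    (u - w - δ) x = Complex.I * τ * schemeForce lam N u w x := by
  have := h x hx
  rw [iteratedDeriv_succ, iteratedDeriv_one] at this
  simp only [Pi.sub_apply, this, schemeForce]
  ring

/-- The residual is `iτ` times the force, so the pairing is purely imaginary. This is the discrete
conservation of energy. -/
lemma DampedStep.ip_force_residual (h : DampedStep lam τ N w u δ) :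
    (ip (schemeForce lam N u w) (u - w - δ)).re = 0 := by
  have : ip (schemeForce lam N u w) (u - w - δ)
      = -Complex.I * τ * ((∫ x in (0 : ℝ)..1, ‖schemeForce lam N u w x‖ ^ 2 : ℝ) : ℂ) := by
    rw [← intervalIntegral.integral_ofReal, ← intervalIntegral.integral_const_mul]
    refine intervalIntegral.integral_congr fun x hx => ?_
    rw [Set.uIcc_of_le zero_le_one] at hx
    simp only [h.residual_eq hx, map_mul, Complex.conj_I, Complex.conj_ofReal]
    push_cast
    rw [← Complex.mul_conj']
    ring
  rw [this]
  simp

/-- Discrete conservation of mass: the force paired with `u` is real, because the nonlinearity is a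
real multiple of `u`. -/
lemma DampedStep.ip_residual_self (h : DampedStep lam τ N w u δ) (hu : u ∈ V N) (hw : w ∈ V N) :
    (ip (u - w - δ) u).re = 0 := by
  have h1 : ip (u - w - δ) u = Complex.I * τ * ip (schemeForce lam N u w) u := by
    unfold ip
    rw [← intervalIntegral.integral_const_mul]
    refine intervalIntegral.integral_congr fun x hx => ?_
    rw [Set.uIcc_of_le zero_le_one] at hx
    simp only [h.residual_eq hx]
    ring
  have h2 : ip (deriv u) (deriv u) = ((∫ x in (0 : ℝ)..1, ‖deriv u x‖ ^ 2 : ℝ) : ℂ) := by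
    rw [← intervalIntegral.integral_ofReal]
    simp [ip, Complex.mul_conj']
  have h3 : ip (schemeNonlin u w) u
      = ((∫ x in (0 : ℝ)..1, (‖u x‖ ^ 2 + ‖w x‖ ^ 2) / 2 * ‖u x‖ ^ 2 : ℝ) : ℂ) := by
    rw [← intervalIntegral.integral_ofReal]
    simp [ip, schemeNonlin, mul_assoc, Complex.mul_conj']
  rw [h1, ip_schemeForce hu hw hu, h2, h3]
  simp

lemma DampedStep.massSq_le (h : DampedStep lam τ N w u δ) (hu : u ∈ V N) (hw : w ∈ V N)
    (hδ : δ ∈ V N) : massSq u ≤ 2 * massSq w + 2 * massSq δ := by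
  have hu' := continuous_of_mem_V hu
  have hw' := continuous_of_mem_V hw
  have hδ' := continuous_of_mem_V hδ
  have h0 := h.ip_residual_self hu hw
  rw [re_ip (by fun_prop) hu'] at h0
  have h1 : massSq u ≤ ∫ x in (0 : ℝ)..1, (2 * ‖w x‖ ^ 2 + 2 * ‖δ x‖ ^ 2
      + 2 * ((u - w - δ) x * starRingEnd ℂ (u x)).re) := by
    refine integral_mono_unit (by fun_prop) (by fun_prop) fun x _ => ?_
    simp only [Pi.sub_apply, ← Complex.normSq_eq_norm_sq, Complex.normSq_apply, Complex.mul_re,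
      Complex.conj_re, Complex.conj_im, Complex.sub_re, Complex.sub_im]
    nlinarith [sq_nonneg ((u x).re - (w x).re - (δ x).re), sq_nonneg ((u x).im - (w x).im - (δ x).im),
      sq_nonneg ((w x).re - (δ x).re), sq_nonneg ((w x).im - (δ x).im)]
  rw [intervalIntegral.integral_add (Continuous.intervalIntegrable (by fun_prop) _ _)
    (Continuous.intervalIntegrable (by fun_prop) _ _),
    intervalIntegral.integral_add (Continuous.intervalIntegrable (by fun_prop) _ _)
    (Continuous.intervalIntegrable (by fun_prop) _ _)] at h1
  simp only [intervalIntegral.integral_const_mul] at h1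
  rw [h0] at h1
  simpa [massSq] using h1

lemma massSq_le_gradSq (hδ : δ ∈ V N) : massSq δ ≤ gradSq δ := by
  have := integral_mono_unit (f := fun x => ‖δ x‖ ^ 2) (g := fun _ => gradSq δ)
    (by have := continuous_of_mem_V hδ; fun_prop) continuous_const
    fun x hx => norm_sq_le_of_mem_V hδ hx
  simpa [massSq] using this

lemma quartic_le_gradSq (hδ : δ ∈ V N) : quartic δ ≤ gradSq δ ^ 2 := by
  have := integral_mono_unit (f := fun x => ‖δ x‖ ^ 4) (g := fun _ => gradSq δ ^ 2)
    (by have := continuous_of_mem_V hδ; fun_prop) continuous_const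
    fun x hx => by
      have := pow_le_pow_left₀ (by positivity) (norm_sq_le_of_mem_V hδ hx) 2
      rwa [← pow_mul] at this
  simpa [quartic] using this

/-- The energy inequality of one step of the scheme. -/
lemma DampedStep.energy_le {l : ℝ} (hl : 0 ≤ l) (h : DampedStep (-l) τ N w u δ) (hu : u ∈ V N)
    (hw : w ∈ V N) (hδ : δ ∈ V N) :
    energy (-l) u ≤ energy (-l) w + energyDeriv l w δ
      + (gradSq δ + 12 * (gradSq δ * (l * massSq w)) + 8 * l * gradSq δ ^ 2) := by
  have hu' := continuous_of_mem_V hu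
  have hw' := continuous_of_mem_V hw
  have hδ' := continuous_of_mem_V hδ
  have du := continuous_deriv_of_mem_V hu
  have dw := continuous_deriv_of_mem_V hw
  have dδ := continuous_deriv_of_mem_V hδ
  have hc := continuous_cubic hw'
  have hG := continuous_schemeNonlin hu' hw'
  have hφ : u - w - δ ∈ V N := Submodule.sub_mem _ (Submodule.sub_mem _ hu hw) hδ
  have dφ := continuous_deriv_of_mem_V hφ
  have hdφ : ∀ x, deriv (u - w - δ) x = deriv u x - deriv w x - deriv δ x := fun x =>
    (((differentiable_of_mem_V hu x).hasDerivAt.sub (differentiable_of_mem_V hw x).hasDerivAt).sub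
      (differentiable_of_mem_V hδ x).hasDerivAt).deriv
  have h0 := h.ip_force_residual
  rw [ip_schemeForce hu hw hφ] at h0
  simp only [Complex.add_re, Complex.neg_re, Complex.ofReal_neg, neg_mul, Complex.re_ofReal_mul] at h0
  rw [re_ip du dφ, re_ip hG (by fun_prop)] at h0
  have h1 : gradSq u ≤ ∫ x in (0 : ℝ)..1, (‖deriv w x‖ ^ 2
      + 2 * (deriv w x * starRingEnd ℂ (deriv δ x)).re + ‖deriv δ x‖ ^ 2
      + 2 * (deriv u x * starRingEnd ℂ (deriv (u - w - δ) x)).re) :=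
    integral_mono_unit (by fun_prop) (by fun_prop) fun x _ => by
      rw [hdφ]; exact gradient_pointwise _ _ _
  -- The Sobolev embedding replaces `‖δ x‖ ^ 2` by `gradSq δ`, leaving only masses to control. The
  -- last term cancels against its gradient counterpart by `h0`.
  have h2 : ∫ x in (0 : ℝ)..1, 1 / 2 * ‖u x‖ ^ 4 ≤ ∫ x in (0 : ℝ)..1, (1 / 2 * ‖w x‖ ^ 4
      + 2 * (cubic w x * starRingEnd ℂ (δ x)).re
      + 4 * gradSq δ * (‖u x‖ ^ 2 + ‖w x‖ ^ 2)
      + 2 * (schemeNonlin u w x * starRingEnd ℂ ((u - w - δ) x)).re) := by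
    refine integral_mono_unit (by fun_prop) (by fun_prop) fun x hx => ?_
    have h3 := quartic_pointwise (u x) (w x) (δ x)
    have h4 : (‖u x‖ ^ 2 + ‖w x‖ ^ 2) * ‖δ x‖ ^ 2 ≤ (‖u x‖ ^ 2 + ‖w x‖ ^ 2) * gradSq δ := by
      have := norm_sq_le_of_mem_V hδ hx
      unfold gradSq
      gcongr
    simp only [cubic, schemeNonlin, mul_assoc, Complex.re_ofReal_mul, Pi.sub_apply]
    linarith
  rw [intervalIntegral.integral_add (Continuous.intervalIntegrable (by fun_prop) _ _)
    (Continuous.intervalIntegrable (by fun_prop) _ _),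
    intervalIntegral.integral_add (Continuous.intervalIntegrable (by fun_prop) _ _)
    (Continuous.intervalIntegrable (by fun_prop) _ _),
    intervalIntegral.integral_add (Continuous.intervalIntegrable (by fun_prop) _ _)
    (Continuous.intervalIntegrable (by fun_prop) _ _)] at h1 h2
  rw [intervalIntegral.integral_const_mul, intervalIntegral.integral_const_mul] at h1
  rw [intervalIntegral.integral_const_mul, intervalIntegral.integral_const_mul,
    intervalIntegral.integral_const_mul, intervalIntegral.integral_const_mul,
    intervalIntegral.integral_const_mul,
    intervalIntegral.integral_add (Continuous.intervalIntegrable (by fun_prop) _ _)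
    (Continuous.intervalIntegrable (by fun_prop) _ _)] at h2
  rw [← re_ip dw dδ] at h1
  rw [← re_ip hc hδ'] at h2
  change 1 / 2 * quartic u ≤ 1 / 2 * quartic w + _ + 4 * gradSq δ * (massSq u + massSq w) + _ at h2
  change gradSq u ≤ gradSq w + _ + gradSq δ + _ at h1
  have h5 := h.massSq_le hu hw hδ
  have h6 := massSq_le_gradSq hδ
  -- The mass bound removes the implicit value `u`; the factor 4 in `h2` then gives the constants 12
  -- and 8.
  have h7 : gradSq δ * (massSq u + massSq w) ≤ gradSq δ * (3 * massSq w + 2 * gradSq δ) :=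
    mul_le_mul_of_nonneg_left (by linarith) (gradSq_nonneg δ)
  have h8 := mul_le_mul_of_nonneg_left h2 hl
  have h9 := mul_le_mul_of_nonneg_left h7 hl
  rw [energy_neg, energy_neg, energyDeriv]
  linarith

end Step

/-! ### Growth bounds in terms of the energy -/

lemma massSq_sq_le {w : ℝ → ℂ} (hw : Continuous w) : massSq w ^ 2 ≤ quartic w := by
  have := sq_integral_le (f := fun x => ‖w x‖ ^ 2) (by fun_prop)
  simp only [← pow_mul] at this
  exact this

/-- For `l = 1` the quartic part of the energy dominates the squared mass, so the mass grows only
like the square root of the energy; for `l = 0` the mass term is absent. -/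
lemma mul_massSq_le {l : ℝ} (hl : l = 0 ∨ l = 1) {w : ℝ → ℂ} (hw : Continuous w) :
    l * massSq w ≤ 2 * √(1 + energy (-l) w) := by
  rcases hl with rfl | rfl
  · simp only [zero_mul]; positivity
  · have h1 := massSq_sq_le hw
    have h2 := gradSq_nonneg w
    have h3 := quartic_nonneg w
    rw [energy_neg]
    have h4 : massSq w / 2 ≤ √(1 + (gradSq w + 1 / 2 * quartic w)) := by
      apply Real.le_sqrt_of_sq_le
      nlinarith
    linarith

lemma ip_deriv_sq_le {w δ : ℝ → ℂ} (dw : Continuous (deriv w)) (dδ : Continuous (deriv δ)) :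
    (ip (deriv w) (deriv δ)).re ^ 2 ≤ gradSq w * gradSq δ := by
  have h1 : |(ip (deriv w) (deriv δ)).re| ≤ ∫ x in (0 : ℝ)..1, ‖deriv w x‖ * ‖deriv δ x‖ := by
    rw [re_ip dw dδ]
    refine (intervalIntegral.abs_integral_le_integral_abs zero_le_one).trans ?_
    exact integral_mono_unit (by fun_prop) (by fun_prop) fun x _ => abs_re_mul_conj_le _ _
  rw [← sq_abs]
  exact (pow_le_pow_left₀ (abs_nonneg _) h1 2).trans (sq_integral_mul_le dw.norm dδ.norm)

/-- Take `δ` in sup norm and apply Cauchy–Schwarz to `‖w‖³ = ‖w‖ · ‖w‖²`. This split gives energy to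
the power `1/2 + 1`, below the critical power 2. -/
lemma ip_cubic_sq_le {N : ℕ} {w δ : ℝ → ℂ} (hw : Continuous w) (hδ : δ ∈ V N) :
    (ip (cubic w) δ).re ^ 2 ≤ massSq w * quartic w * gradSq δ := by
  have hδ' := continuous_of_mem_V hδ
  have hc := continuous_cubic hw
  have h1 : |(ip (cubic w) δ).re|
      ≤ (∫ x in (0 : ℝ)..1, ‖w x‖ * ‖w x‖ ^ 2) * √(gradSq δ) := by
    rw [re_ip hc hδ', ← intervalIntegral.integral_mul_const]
    refine (intervalIntegral.abs_integral_le_integral_abs zero_le_one).trans ?_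
    refine integral_mono_unit (by fun_prop) (by fun_prop) fun x hx => ?_
    refine (abs_re_mul_conj_le _ _).trans ?_
    have h2 : ‖δ x‖ ≤ √(gradSq δ) := Real.le_sqrt_of_sq_le (norm_sq_le_of_mem_V hδ hx)
    have h3 : ‖cubic w x‖ = ‖w x‖ * ‖w x‖ ^ 2 := by simp [cubic, mul_comm]
    rw [h3]
    gcongr
  have h2 := sq_integral_mul_le (f := fun x => ‖w x‖) (g := fun x => ‖w x‖ ^ 2) hw.norm (hw.norm.pow 2)
  simp only [← pow_mul] at h2
  rw [← sq_abs]
  refine (pow_le_pow_left₀ (abs_nonneg _) h1 2).trans ?_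
  rw [mul_pow, Real.sq_sqrt (gradSq_nonneg δ)]
  exact mul_le_mul_of_nonneg_right h2 (gradSq_nonneg δ)

lemma energyDeriv_sq_le {l : ℝ} (hl : l = 0 ∨ l = 1) {N : ℕ} {w δ : ℝ → ℂ} (hw : w ∈ V N)
    (hδ : δ ∈ V N) :
    energyDeriv l w δ ^ 2 ≤ 40 * √(1 + energy (-l) w) ^ 3 * gradSq δ := by
  have h0 : 0 ≤ l := by rcases hl with rfl | rfl <;> norm_num
  have hE := energy_neg_nonneg h0 w
  have h1 := ip_deriv_sq_le (continuous_deriv_of_mem_V hw) (continuous_deriv_of_mem_V hδ)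
  have h2 := ip_cubic_sq_le (continuous_of_mem_V hw) hδ
  have h3 := mul_massSq_le hl (continuous_of_mem_V hw)
  have hs : √(1 + energy (-l) w) ^ 2 = 1 + energy (-l) w := Real.sq_sqrt (by linarith)
  have hs1 : 1 ≤ √(1 + energy (-l) w) := Real.one_le_sqrt.2 (by linarith)
  have hY := gradSq_nonneg δ
  have hg : gradSq w ≤ √(1 + energy (-l) w) ^ 2 := by
    rw [hs, energy_neg]
    have := quartic_nonneg w
    have : 0 ≤ l / 2 * quartic w := by positivity
    linarith
  have hq : l * quartic w ≤ 2 * √(1 + energy (-l) w) ^ 2 := by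
    rw [hs, energy_neg]
    have := gradSq_nonneg w
    linarith
  have hll : l ^ 2 = l * l := sq l
  have hmq : l ^ 2 * (massSq w * quartic w) ≤ 4 * √(1 + energy (-l) w) ^ 3 := by
    have := mul_le_mul h3 hq (mul_nonneg h0 (quartic_nonneg w)) (by positivity)
    nlinarith
  generalize √(1 + energy (-l) w) = s at *
  have h4 : l ^ 2 * (ip (cubic w) δ).re ^ 2 ≤ 4 * s ^ 3 * gradSq δ := by
    have := mul_le_mul_of_nonneg_left h2 (sq_nonneg l)
    have := mul_le_mul_of_nonneg_right hmq hY
    nlinarith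
  have h5 : (ip (deriv w) (deriv δ)).re ^ 2 ≤ s ^ 3 * gradSq δ := by
    refine h1.trans (mul_le_mul_of_nonneg_right (hg.trans ?_) hY)
    exact pow_le_pow_right₀ hs1 (by norm_num)
  unfold energyDeriv
  -- `(2a + 2b)² ≤ 8(a² + b²)` with the bounds `1` and `4` gives `8 · 5 = 40`.
  nlinarith [sq_nonneg ((ip (deriv w) (deriv δ)).re - l * (ip (cubic w) δ).re)]

/-! ### Powers of the energy -/

/-- Each binomial term of order at least two in `X` lies below one of the extreme ones, according as
`|X| ≤ S` or not. The even exponent keeps the top power of `X` nonnegative for either sign of `X`.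
-/
lemma add_pow_le_taylor {S : ℝ} (hS : 0 ≤ S) (X : ℝ) (r : ℕ) :
    (S + X) ^ (2 * r + 2) ≤ S ^ (2 * r + 2) + (2 * r + 2) * (S ^ (2 * r + 1) * X)
      + 2 ^ (2 * r + 2) * (S ^ (2 * r) * X ^ 2 + X ^ (2 * r + 2)) := by
  have hterm : ∀ m ∈ Finset.range (2 * r + 1),
      X ^ (m + 2) * S ^ (2 * r - m) ≤ S ^ (2 * r) * X ^ 2 + X ^ (2 * r + 2) := by
    intro m hm
    have hm' : m ≤ 2 * r := by simpa [Nat.lt_succ_iff] using hm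
    have he : X ^ (2 * r + 2) = |X| ^ (2 * r + 2) :=
      (Even.pow_abs ⟨r + 1, by ring⟩ X).symm
    have h1 : X ^ (m + 2) * S ^ (2 * r - m) ≤ |X| ^ (m + 2) * S ^ (2 * r - m) := by
      rw [← abs_pow]
      exact mul_le_mul_of_nonneg_right (le_abs_self _) (by positivity)
    refine h1.trans ?_
    rcases le_total |X| S with h | h
    · have : |X| ^ (m + 2) * S ^ (2 * r - m) ≤ S ^ (2 * r) * X ^ 2 := by
        calc |X| ^ (m + 2) * S ^ (2 * r - m) = |X| ^ m * S ^ (2 * r - m) * X ^ 2 := by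
              rw [pow_add, sq_abs]; ring
          _ ≤ S ^ m * S ^ (2 * r - m) * X ^ 2 := by gcongr
          _ = _ := by rw [← pow_add, Nat.add_sub_of_le hm']
      have h2 : 0 ≤ X ^ (2 * r + 2) := by rw [he]; positivity
      linarith
    · have : |X| ^ (m + 2) * S ^ (2 * r - m) ≤ |X| ^ (2 * r + 2) := by
        calc |X| ^ (m + 2) * S ^ (2 * r - m) ≤ |X| ^ (m + 2) * |X| ^ (2 * r - m) := by gcongr
          _ = _ := by rw [← pow_add]; congr 1; omega
      have h2 : 0 ≤ S ^ (2 * r) * X ^ 2 := by positivity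
      rw [he]
      linarith
  have hT : 0 ≤ S ^ (2 * r) * X ^ 2 + X ^ (2 * r + 2) := by
    have : 0 ≤ X ^ (2 * r + 2) := Even.pow_nonneg ⟨r + 1, by ring⟩ X
    positivity
  generalize hTd : S ^ (2 * r) * X ^ 2 + X ^ (2 * r + 2) = T at *
  rw [add_comm S X, add_pow, Finset.sum_range_succ', Finset.sum_range_succ']
  have hsum : ∑ m ∈ Finset.range (2 * r + 1), X ^ (m + 1 + 1) * S ^ (2 * r + 2 - (m + 1 + 1))
        * ((2 * r + 2).choose (m + 1 + 1) : ℝ) ≤ 2 ^ (2 * r + 2) * T := by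
    calc _ ≤ ∑ m ∈ Finset.range (2 * r + 1), T * ((2 * r + 2).choose (m + 1 + 1) : ℝ) := by
          refine Finset.sum_le_sum fun m hm => mul_le_mul_of_nonneg_right ?_ (by positivity)
          rw [show 2 * r + 2 - (m + 1 + 1) = 2 * r - m by omega]
          exact hterm m hm
      _ = T * ∑ m ∈ Finset.range (2 * r + 1), ((2 * r + 2).choose (m + 1 + 1) : ℝ) := by
          rw [Finset.mul_sum]
      _ ≤ T * 2 ^ (2 * r + 2) := by
          refine mul_le_mul_of_nonneg_left ?_ hT
          have h := Nat.sum_range_choose (2 * r + 2)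
          rw [Finset.sum_range_succ', Finset.sum_range_succ'] at h
          have h' : ∑ m ∈ Finset.range (2 * r + 1), (2 * r + 2).choose (m + 1 + 1)
            ≤ 2 ^ (2 * r + 2) := by omega
          exact_mod_cast h'
      _ = _ := mul_comm _ _
  simp only [zero_add, pow_one, pow_zero, Nat.choose_zero_right, Nat.choose_one_right,
    Nat.sub_zero, one_mul, Nat.cast_one, mul_one, Nat.reduceAdd, Nat.add_assoc,
    Nat.add_sub_add_right] at hsum ⊢
  rw [show 2 * r + 2 - 1 = 2 * r + 1 by omega]
  push_cast
  linarith

/-- The constant in `one_add_pow_le`. -/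
def stepConst (r : ℕ) : ℝ := (2 * r + 2) * 33 + 2 ^ (2 * r + 2) * (6000 + 6000 ^ (r + 1))

lemma stepConst_pos (r : ℕ) : 0 < stepConst r := by unfold stepConst; positivity

/-- Taylor with `S = s²` and `X = M + R`, where `R` is of order `s` and `X²` of order `s³`. The
error terms carry `s^(4r+2) · s`, `s^(4r) · s³` and `s^(3r+3)`, all at most `s^(4r+3)`: one power of
`s` below the leading term. `Y + Y ^ 4` serves as a common majorant of `Y`, `Y²` and `Y⁴`. -/
lemma power_step_le {s Y M : ℝ} (hs : 1 ≤ s) (hY : 0 ≤ Y) (hM : M ^ 2 ≤ 40 * s ^ 3 * Y) (r : ℕ) :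
    (s ^ 2 + (M + s * (25 * Y + 8 * Y ^ 2))) ^ (2 * r + 2)
      ≤ (s ^ 2) ^ (2 * r + 2) + (2 * r + 2) * ((s ^ 2) ^ (2 * r + 1) * M)
        + stepConst r * (s ^ (4 * r + 3) * ((Y + Y ^ 4) + (Y + Y ^ 4) ^ (r + 1))) := by
  set R := s * (25 * Y + 8 * Y ^ 2) with hR
  set Z := Y + Y ^ 4 with hZ
  have hs0 : 0 ≤ s := by linarith
  have hYZ : Y ≤ Z := by rw [hZ]; have : 0 ≤ Y ^ 4 := by positivity
                         linarith
  have hZ0 : 0 ≤ Z := hY.trans hYZ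
  have hY2 : Y ^ 2 ≤ Z := by
    rcases le_total Y 1 with h | h
    · have := mul_le_mul_of_nonneg_left h hY
      nlinarith
    · have := pow_le_pow_right₀ h (show 2 ≤ 4 by norm_num)
      linarith
  have hR1 : R ≤ 33 * (s * Z) := by
    rw [hR]; nlinarith
  have hR2 : R ^ 2 ≤ 2500 * (s ^ 3 * Z) := by
    have h1 : (25 * Y + 8 * Y ^ 2) ^ 2 ≤ 2500 * Z := by
      have : Y ^ 4 ≤ Z := by rw [hZ]; linarith
      nlinarith [sq_nonneg (25 * Y - 8 * Y ^ 2)]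
    calc R ^ 2 = s ^ 2 * (25 * Y + 8 * Y ^ 2) ^ 2 := by rw [hR]; ring
      _ ≤ s ^ 3 * (2500 * Z) := by
          gcongr
          norm_num
      _ = _ := by ring
  have hX : (M + R) ^ 2 ≤ 6000 * (s ^ 3 * Z) := by
    have : s ^ 3 * Y ≤ s ^ 3 * Z := by gcongr
    nlinarith [sq_nonneg (M - R)]
  have hX0 : 0 ≤ s ^ 3 * Z := by positivity
  have h1 := add_pow_le_taylor (sq_nonneg s) (M + R) r
  have h2 : (s ^ 2) ^ (2 * r + 1) * R ≤ 33 * (s ^ (4 * r + 3) * Z) := by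
    calc _ ≤ (s ^ 2) ^ (2 * r + 1) * (33 * (s * Z)) := by gcongr
      _ = _ := by rw [← pow_mul]; ring
  have h3 : (s ^ 2) ^ (2 * r) * (M + R) ^ 2 ≤ 6000 * (s ^ (4 * r + 3) * Z) := by
    calc _ ≤ (s ^ 2) ^ (2 * r) * (6000 * (s ^ 3 * Z)) := by gcongr
      _ = _ := by rw [← pow_mul]; ring
  have h4 : (M + R) ^ (2 * r + 2) ≤ 6000 ^ (r + 1) * (s ^ (4 * r + 3) * Z ^ (r + 1)) := by
    calc (M + R) ^ (2 * r + 2) = ((M + R) ^ 2) ^ (r + 1) := by rw [← pow_mul]; congr 1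
      _ ≤ (6000 * (s ^ 3 * Z)) ^ (r + 1) := by gcongr
      _ = 6000 ^ (r + 1) * (s ^ (3 * r + 3) * Z ^ (r + 1)) := by
          rw [mul_pow, mul_pow, ← pow_mul]; ring
      _ ≤ _ := by
          gcongr
          norm_num
  have hA : 0 ≤ s ^ (4 * r + 3) * Z := by positivity
  have hB : 0 ≤ s ^ (4 * r + 3) * Z ^ (r + 1) := by positivity
  generalize hAd : s ^ (4 * r + 3) * Z = A at *
  generalize hBd : s ^ (4 * r + 3) * Z ^ (r + 1) = B at *
  have h5 : (2 * (r : ℝ) + 2) * ((s ^ 2) ^ (2 * r + 1) * R) ≤ (2 * r + 2) * (33 * A) := by gcongr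
  have h6 : (2 : ℝ) ^ (2 * r + 2) * ((s ^ 2) ^ (2 * r) * (M + R) ^ 2 + (M + R) ^ (2 * r + 2))
      ≤ 2 ^ (2 * r + 2) * (6000 * A + 6000 ^ (r + 1) * B) := by gcongr
  have h7 : (2 * (r : ℝ) + 2) * (33 * A) + 2 ^ (2 * r + 2) * (6000 * A + 6000 ^ (r + 1) * B)
      ≤ stepConst r * (A + B) := by
    have e1 : 0 ≤ 2 ^ (2 * r + 2) * 6000 ^ (r + 1) * A := by positivity
    have e2 : 0 ≤ ((2 * (r : ℝ) + 2) * 33 + 2 ^ (2 * r + 2) * 6000) * B := by positivity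
    unfold stepConst
    linarith
  rw [mul_add (s ^ (4 * r + 3)), hAd, hBd]
  linarith

/-- The pathwise inequality for powers of the energy. -/
lemma DampedStep.one_add_energy_pow_le {N : ℕ} {τ l : ℝ} {u w δ : ℝ → ℂ} (hl : l = 0 ∨ l = 1)
    (h : DampedStep (-l) τ N w u δ) (hu : u ∈ V N) (hw : w ∈ V N) (hδ : δ ∈ V N) (r : ℕ) :
    (1 + energy (-l) u) ^ (2 * r + 2)
      ≤ (1 + energy (-l) w) ^ (2 * r + 2)
        + (2 * r + 2) * ((1 + energy (-l) w) ^ (2 * r + 1) * energyDeriv l w δ)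
        + stepConst r * (√(1 + energy (-l) w) ^ (4 * r + 3) *
          ((gradSq δ + gradSq δ ^ 4) + (gradSq δ + gradSq δ ^ 4) ^ (r + 1))) := by
  have h0 : 0 ≤ l := by rcases hl with rfl | rfl <;> norm_num
  have h01 : l ≤ 1 := by rcases hl with rfl | rfl <;> norm_num
  have hE := energy_neg_nonneg h0 w
  have hEu := energy_neg_nonneg h0 u
  have hs : √(1 + energy (-l) w) ^ 2 = 1 + energy (-l) w := Real.sq_sqrt (by linarith)
  have hs1 : 1 ≤ √(1 + energy (-l) w) := Real.one_le_sqrt.2 (by linarith)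
  have hm := mul_massSq_le hl (continuous_of_mem_V hw)
  have hY := gradSq_nonneg δ
  have h1 := h.energy_le h0 hu hw hδ
  have h2 := power_step_le hs1 hY (energyDeriv_sq_le hl hw hδ) r
  rw [hs] at h2
  -- The coefficient 25 is `1 + 12 · 2`: the pure gradient term and the mass term with `l * massSq w
  -- ≤ 2s`.
  refine le_trans (pow_le_pow_left₀ (by linarith) ?_ _) h2
  have h3 : gradSq δ * (l * massSq w) ≤ gradSq δ * (2 * √(1 + energy (-l) w)) := by gcongr
  have h4 : gradSq δ ≤ √(1 + energy (-l) w) * gradSq δ := le_mul_of_one_le_left hY hs1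
  have h5 : l * gradSq δ ^ 2 ≤ √(1 + energy (-l) w) * gradSq δ ^ 2 := by
    gcongr; linarith
  linarith

/-- Young-type inequality that spends the missing power of `s` to obtain a small factor. -/
lemma pow_le_eps {s ε : ℝ} (hs : 0 ≤ s) (hε : 0 < ε) (n : ℕ) :
    s ^ n ≤ ε * s ^ (n + 1) + (1 / ε) ^ n := by
  rcases le_total 1 (ε * s) with h | h
  · have : s ^ n ≤ ε * s ^ (n + 1) := by
      calc s ^ n = 1 * s ^ n := (one_mul _).symm
        _ ≤ (ε * s) * s ^ n := by gcongr
        _ = _ := by ring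
    have : 0 ≤ (1 / ε) ^ n := by positivity
    linarith
  · have : s ^ n ≤ (1 / ε) ^ n := by
      refine pow_le_pow_left₀ hs ?_ n
      rw [le_div_iff₀ hε]; linarith
    have : 0 ≤ ε * s ^ (n + 1) := by positivity
    linarith

/-! ### Damping -/

lemma energy_smul_le {l a : ℝ} (hl : 0 ≤ l) (ha : 0 ≤ a) (ha1 : a ≤ 1) {N : ℕ} {v : ℝ → ℂ}
    (hv : v ∈ V N) : energy (-l) (fun x => (a : ℂ) * v x) ≤ a * energy (-l) v := by
  have hg : gradSq (fun x => (a : ℂ) * v x) = a ^ 2 * gradSq v := by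
    unfold gradSq
    rw [← intervalIntegral.integral_const_mul]
    congr 1; ext x
    rw [deriv_const_mul _ (differentiable_of_mem_V hv x)]
    simp [mul_pow]
  have hq : quartic (fun x => (a : ℂ) * v x) = a ^ 4 * quartic v := by
    unfold quartic
    rw [← intervalIntegral.integral_const_mul]
    congr 1; ext x
    simp only [Complex.norm_mul, Complex.norm_real, Real.norm_eq_abs, mul_pow,
      Even.pow_abs (⟨2, rfl⟩ : Even 4)]
  rw [energy_neg, energy_neg, hg, hq]
  have h1 : a ^ 2 * gradSq v ≤ a * gradSq v :=
    mul_le_mul_of_nonneg_right (pow_le_of_le_one ha ha1 (by norm_num)) (gradSq_nonneg v)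
  have h2 : a ^ 4 * (l / 2 * quartic v) ≤ a * (l / 2 * quartic v) :=
    mul_le_mul_of_nonneg_right (pow_le_of_le_one ha ha1 (by norm_num))
      (mul_nonneg (by linarith) (quartic_nonneg v))
  linarith

lemma exp_neg_le {x : ℝ} (h0 : 0 ≤ x) (h1 : x ≤ 1) : Real.exp (-x) ≤ 1 - x / 2 := by
  rw [Real.exp_neg, inv_le_comm₀ (Real.exp_pos x) (by linarith)]
  refine le_trans ?_ (Real.add_one_le_exp x)
  rw [inv_le_iff_one_le_mul₀ (by linarith)]
  nlinarith

/-- Convexity of the power at the convex combination `(1 - θ)(1 + H) + θ · 1`; it passes the damping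
to powers of `1 + H` without losing the rate. -/
lemma one_add_mul_pow_le {H θ b : ℝ} (hH : 0 ≤ H) (h0 : 0 ≤ θ) (h1 : θ ≤ 1) (hb : 0 ≤ b)
    (hbθ : b ≤ (1 - θ) * H) (n : ℕ) : (1 + b) ^ n ≤ (1 - θ) * (1 + H) ^ n + θ := by
  have h := (convexOn_pow (𝕜 := ℝ) n).2 (show 1 + H ∈ Set.Ici 0 by simp; linarith)
    (show (1 : ℝ) ∈ Set.Ici 0 by simp) (show 0 ≤ 1 - θ by linarith) h0 (by ring)
  simp only [smul_eq_mul, mul_one, one_pow] at h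
  refine le_trans (pow_le_pow_left₀ (by linarith) ?_ n) h
  linarith

/-! ### Gaussian increments -/

/-- The even moments of the standard Gaussian law. -/
def gaussMoment (j : ℕ) : ℝ := ∫ x, x ^ (2 * j) ∂gaussianReal 0 1

lemma gaussMoment_nonneg (j : ℕ) : 0 ≤ gaussMoment j :=
  integral_nonneg fun x => by
    simp only [Pi.zero_apply]; rw [pow_mul]; positivity

lemma integrable_pow_gaussianReal (v : ℝ≥0) (j : ℕ) :
    Integrable (fun x : ℝ => x ^ j) (gaussianReal 0 v) := by
  have h := (memLp_id_gaussianReal (μ := 0) (v := v) (j : ℝ≥0)).integrable_norm_pow'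
  refine (integrable_norm_iff (by fun_prop)).1 ?_
  simpa using h

lemma integral_even_pow_gaussianReal (v : ℝ≥0) (j : ℕ) :
    ∫ x, x ^ (2 * j) ∂gaussianReal 0 v = (v : ℝ) ^ j * gaussMoment j := by
  have h := gaussianReal_map_const_mul (μ := 0) (v := 1) (√(v : ℝ))
  have hv : (NNReal.mk (√(v : ℝ) ^ 2) (sq_nonneg _) * 1 : ℝ≥0) = v := by
    ext; simp
  rw [mul_zero, hv] at h
  rw [← h, integral_map (by fun_prop) (by fun_prop), gaussMoment, ← integral_const_mul]
  congr 1; ext x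
  rw [mul_pow, pow_mul (√(v : ℝ)), show √(v : ℝ) ^ 2 = v from Real.sq_sqrt v.coe_nonneg]

variable {Ω : Type*} {mΩ : MeasurableSpace Ω} {P : Measure Ω}

lemma integrable_pow_of_hasLaw {X : Ω → ℝ} {v : ℝ≥0} (hX : HasLaw X (gaussianReal 0 v) P) (j : ℕ) :
    Integrable (fun ω => X ω ^ j) P := by
  have h := integrable_pow_gaussianReal v j
  rw [← hX.map_eq] at h
  exact (integrable_map_measure (continuous_pow j).aestronglyMeasurable hX.aemeasurable).1 h

lemma integral_even_pow_of_hasLaw {X : Ω → ℝ} {v : ℝ≥0} (hX : HasLaw X (gaussianReal 0 v) P)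
    (j : ℕ) : ∫ ω, X ω ^ (2 * j) ∂P = (v : ℝ) ^ j * gaussMoment j := by
  rw [← integral_even_pow_gaussianReal]
  exact hX.integral_comp (f := fun x => x ^ (2 * j)) (by fun_prop)

lemma integral_of_hasLaw {X : Ω → ℝ} {v : ℝ≥0} (hX : HasLaw X (gaussianReal 0 v) P) :
    ∫ ω, X ω ∂P = 0 := by
  rw [hX.integral_eq, integral_id_gaussianReal]

variable {β : ℕ → ℝ≥0 → Ω → ℂ} {ℱ : Filtration ℝ≥0 mΩ}

lemma IsCylindricalWiener.hasLaw_re (hβ : IsCylindricalWiener β ℱ P) (m : ℕ) (s τ : ℝ≥0) :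
    HasLaw (fun ω => (β m (s + τ) ω - β m s ω).re) (gaussianReal 0 τ) P := by
  have := (hβ.brownian (m, false)).hasLaw_sub (s + τ) s
  have h2 : nndist ((s + τ : ℝ≥0) : ℝ) (s : ℝ) = τ := by
    ext; simp
  rw [show nndist (s + τ).1 s.1 = τ from h2] at this
  exact this

lemma IsCylindricalWiener.hasLaw_im (hβ : IsCylindricalWiener β ℱ P) (m : ℕ) (s τ : ℝ≥0) :
    HasLaw (fun ω => (β m (s + τ) ω - β m s ω).im) (gaussianReal 0 τ) P := by
  have := (hβ.brownian (m, true)).hasLaw_sub (s + τ) s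
  have h2 : nndist ((s + τ : ℝ≥0) : ℝ) (s : ℝ) = τ := by
    ext; simp
  rw [show nndist (s + τ).1 s.1 = τ from h2] at this
  exact this

lemma IsCylindricalWiener.measurable_incr (hβ : IsCylindricalWiener β ℱ P) (m : ℕ) (s t : ℝ≥0) :
    Measurable (fun ω => β m t ω - β m s ω) :=
  ((hβ.adapted m t).mono (ℱ.le t) le_rfl).sub ((hβ.adapted m s).mono (ℱ.le s) le_rfl)

lemma norm_pow_le_re_im (z : ℂ) (j : ℕ) :
    ‖z‖ ^ (2 * j) ≤ 2 ^ j * (z.re ^ (2 * j) + z.im ^ (2 * j)) := by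
  have h : ‖z‖ ^ 2 = z.re ^ 2 + z.im ^ 2 := by
    rw [← Complex.normSq_eq_norm_sq, Complex.normSq_apply]; ring
  rw [pow_mul, h, pow_mul, pow_mul]
  refine (add_pow_le (sq_nonneg _) (sq_nonneg _) j).trans ?_
  gcongr
  · norm_num
  · omega

lemma IsCylindricalWiener.integrable_norm_pow (hβ : IsCylindricalWiener β ℱ P) (m : ℕ)
    (s τ : ℝ≥0) (j : ℕ) : Integrable (fun ω => ‖β m (s + τ) ω - β m s ω‖ ^ (2 * j)) P := by
  have h := ((integrable_pow_of_hasLaw (hβ.hasLaw_re m s τ) (2 * j)).add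
    (integrable_pow_of_hasLaw (hβ.hasLaw_im m s τ) (2 * j))).const_mul (2 ^ j)
  refine h.mono' ((hβ.measurable_incr m s (s + τ)).norm.pow_const _).aestronglyMeasurable ?_
  refine Filter.Eventually.of_forall fun ω => ?_
  rw [Real.norm_of_nonneg (by positivity)]
  exact norm_pow_le_re_im _ _

lemma IsCylindricalWiener.integral_norm_pow_le (hβ : IsCylindricalWiener β ℱ P) (m : ℕ)
    (s τ : ℝ≥0) (j : ℕ) :
    ∫ ω, ‖β m (s + τ) ω - β m s ω‖ ^ (2 * j) ∂P ≤ 2 ^ (j + 1) * gaussMoment j * (τ : ℝ) ^ j := by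
  have h1 := integrable_pow_of_hasLaw (hβ.hasLaw_re m s τ) (2 * j)
  have h2 := integrable_pow_of_hasLaw (hβ.hasLaw_im m s τ) (2 * j)
  refine (integral_mono (hβ.integrable_norm_pow m s τ j) ((h1.add h2).const_mul (2 ^ j))
    fun ω => norm_pow_le_re_im _ _).trans (le_of_eq ?_)
  simp only [Pi.add_apply]
  rw [integral_const_mul, integral_add h1 h2, integral_even_pow_of_hasLaw (hβ.hasLaw_re m s τ),
    integral_even_pow_of_hasLaw (hβ.hasLaw_im m s τ)]
  ring

lemma IsCylindricalWiener.integrable_incr [IsProbabilityMeasure P]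
    (hβ : IsCylindricalWiener β ℱ P) (m : ℕ) (s τ : ℝ≥0) :
    Integrable (fun ω => β m (s + τ) ω - β m s ω) P := by
  refine ((integrable_const (1 : ℝ)).add (hβ.integrable_norm_pow m s τ 1)).mono'
    (hβ.measurable_incr m s (s + τ)).aestronglyMeasurable ?_
  refine Filter.Eventually.of_forall fun ω => ?_
  simp only [Pi.add_apply, mul_one]
  nlinarith [sq_nonneg (‖β m (s + τ) ω - β m s ω‖ - 1), norm_nonneg (β m (s + τ) ω - β m s ω)]

lemma IsCylindricalWiener.integral_incr [IsProbabilityMeasure P]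
    (hβ : IsCylindricalWiener β ℱ P) (m : ℕ) (s τ : ℝ≥0) :
    ∫ ω, (β m (s + τ) ω - β m s ω) ∂P = 0 := by
  have h := hβ.integrable_incr m s τ
  apply Complex.ext
  · rw [← RCLike.re_eq_complex_re, ← integral_re h]
    exact integral_of_hasLaw (hβ.hasLaw_re m s τ)
  · rw [← RCLike.im_eq_complex_im, ← integral_im h]
    exact integral_of_hasLaw (hβ.hasLaw_im m s τ)

/-- The `σ`-algebra of the increments between `s` and `t`. -/
abbrev incrAlg (β : ℕ → ℝ≥0 → Ω → ℂ) (s t : ℝ≥0) : MeasurableSpace Ω :=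
  MeasurableSpace.comap (fun ω m ↦ β m t ω - β m s ω) MeasurableSpace.pi

lemma measurable_incrAlg (β : ℕ → ℝ≥0 → Ω → ℂ) (s t : ℝ≥0) (m : ℕ) :
    Measurable[incrAlg β s t] (fun ω => β m t ω - β m s ω) := by
  have h : Measurable[incrAlg β s t] (fun ω (m : ℕ) ↦ β m t ω - β m s ω) :=
    comap_measurable _
  exact (measurable_pi_apply m).comp h

lemma IsCylindricalWiener.indepFun {E F : Type*} [MeasurableSpace E] [MeasurableSpace F]
    (hβ : IsCylindricalWiener β ℱ P) {s t : ℝ≥0} (hst : s ≤ t) {X : Ω → E} {Y : Ω → F}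
    (hX : Measurable[incrAlg β s t] X) (hY : Measurable[ℱ s] Y) : IndepFun X Y P :=
  indep_of_indep_of_le_left (indep_of_indep_of_le_right (hβ.indep_increment s t hst) hY.comap_le)
    hX.comap_le

/-! ### Moments of the noise -/

variable {η : ℕ → ℝ}

lemma noiseIncr_eq (η : ℕ → ℝ) (β : ℕ → ℝ≥0 → Ω → ℂ) (N : ℕ) (s t : ℝ≥0) (ω : Ω) :
    noiseIncr η β N s t ω = sinSum N (fun m => (√(η m) : ℂ) * (β m t ω - β m s ω)) := rfl

lemma gradSq_noiseIncr (hη : ∀ m, 0 ≤ η m) (N : ℕ) (s t : ℝ≥0) (ω : Ω) :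
    gradSq (noiseIncr η β N s t ω)
      = ∑ m ∈ Finset.range N, η m * freq m ^ 2 * ‖β m t ω - β m s ω‖ ^ 2 := by
  rw [noiseIncr_eq, gradSq, integral_norm_deriv_sinSum_sq]
  refine Finset.sum_congr rfl fun m _ => ?_
  rw [norm_mul, mul_pow, Complex.norm_real, Real.norm_eq_abs, sq_abs, Real.sq_sqrt (hη m)]
  ring

/-- Jensen with the weights `a i` normalised by their sum. The bound sees the number of terms only
through `∑ a i`; a zero sum is handled apart. -/
lemma sum_mul_pow_le {ι : Type*} (s : Finset ι) (a z : ι → ℝ) (ha : ∀ i, 0 ≤ a i)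
    (hz : ∀ i, 0 ≤ z i) (j : ℕ) :
    (∑ i ∈ s, a i * z i) ^ (j + 1) ≤ (∑ i ∈ s, a i) ^ j * ∑ i ∈ s, a i * z i ^ (j + 1) := by
  rcases (Finset.sum_nonneg fun i (_ : i ∈ s) => ha i).eq_or_lt with h | h
  · have h0 : ∀ i ∈ s, a i = 0 :=
      (Finset.sum_eq_zero_iff_of_nonneg fun i _ => ha i).1 h.symm
    rw [Finset.sum_eq_zero fun i hi => by rw [h0 i hi, zero_mul]]
    have : 0 ≤ ∑ i ∈ s, a i * z i ^ (j + 1) :=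
      Finset.sum_nonneg fun i _ => mul_nonneg (ha i) (pow_nonneg (hz i) _)
    rw [zero_pow (by omega)]
    exact mul_nonneg (pow_nonneg h.le _) this
  · set A := ∑ i ∈ s, a i with hA
    have := Real.pow_arith_mean_le_arith_mean_pow s (fun i => a i / A) z
      (fun i _ => div_nonneg (ha i) h.le) (by rw [← Finset.sum_div, div_self h.ne'])
      (fun i _ => hz i) (j + 1)
    simp only [div_mul_eq_mul_div] at this
    rw [← Finset.sum_div, ← Finset.sum_div, div_pow, div_le_div_iff₀ (by positivity) h] at this
    refine le_of_mul_le_mul_right (this.trans (le_of_eq ?_)) h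
    ring

/-- The bound for the `(j+1)`-st moment of `‖∇δW‖²`. -/
def noiseMoment (A α : ℝ) (j : ℕ) : ℝ :=
  A ^ (j + 1) * (2 ^ (j + 2) * gaussMoment (j + 1)) * (1 / α) ^ j

lemma measurable_gradSq_noiseIncr (hη : ∀ m, 0 ≤ η m) (N : ℕ) (s t : ℝ≥0) :
    Measurable[incrAlg β s t] (fun ω => gradSq (noiseIncr η β N s t ω)) := by
  simp_rw [gradSq_noiseIncr hη]
  let _ : MeasurableSpace Ω := incrAlg β s t
  exact Finset.measurable_fun_sum _ fun m _ =>
    ((measurable_incrAlg β s t m).norm.pow_const 2).const_mul _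

lemma IsCylindricalWiener.incrAlg_le (hβ : IsCylindricalWiener β ℱ P) (s t : ℝ≥0) :
    incrAlg β s t ≤ mΩ :=
  (measurable_pi_lambda _ fun m => hβ.measurable_incr m s t).comap_le

lemma IsCylindricalWiener.gradSq_pow (hβ : IsCylindricalWiener β ℱ P) (hη : ∀ m, 0 ≤ η m)
    {A α : ℝ} (hA : ∀ N, ∑ m ∈ Finset.range N, η m * freq m ^ 2 ≤ A) (hα : 0 < α) (N : ℕ)
    (s τ : ℝ≥0) (hτ : α * τ ≤ 1) (j : ℕ) :
    Integrable (fun ω => gradSq (noiseIncr η β N s (s + τ) ω) ^ (j + 1)) P ∧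
      ∫ ω, gradSq (noiseIncr η β N s (s + τ) ω) ^ (j + 1) ∂P ≤ noiseMoment A α j * τ := by
  have ha : ∀ m, 0 ≤ η m * freq m ^ 2 := fun m => mul_nonneg (hη m) (sq_nonneg _)
  have hA0 : 0 ≤ A := by simpa using hA 0
  have hle : ∀ ω, gradSq (noiseIncr η β N s (s + τ) ω) ^ (j + 1) ≤
      A ^ j * ∑ m ∈ Finset.range N,
        η m * freq m ^ 2 * ‖β m (s + τ) ω - β m s ω‖ ^ (2 * (j + 1)) := by
    intro ω
    rw [gradSq_noiseIncr hη]
    refine (sum_mul_pow_le _ _ _ ha (fun m => sq_nonneg _) j).trans ?_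
    simp_rw [← pow_mul]
    refine mul_le_mul_of_nonneg_right
      (pow_le_pow_left₀ (Finset.sum_nonneg fun m _ => ha m) (hA N) j) ?_
    exact Finset.sum_nonneg fun m _ => mul_nonneg (ha m) (by positivity)
  have hint : Integrable (fun ω => A ^ j * ∑ m ∈ Finset.range N,
        η m * freq m ^ 2 * ‖β m (s + τ) ω - β m s ω‖ ^ (2 * (j + 1))) P :=
    (integrable_finsetSum _ fun m _ => (hβ.integrable_norm_pow m s τ (j + 1)).const_mul _).const_mul _
  have hI : Integrable (fun ω => gradSq (noiseIncr η β N s (s + τ) ω) ^ (j + 1)) P := by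
    refine hint.mono' (((measurable_gradSq_noiseIncr hη N s (s + τ)).mono
      (hβ.incrAlg_le _ _) le_rfl).pow_const _).aestronglyMeasurable
      (Filter.Eventually.of_forall fun ω => ?_)
    rw [Real.norm_of_nonneg (pow_nonneg (gradSq_nonneg _) _)]
    exact hle ω
  refine ⟨hI, (integral_mono hI hint hle).trans ?_⟩
  rw [integral_const_mul, integral_finsetSum _
    fun m _ => (hβ.integrable_norm_pow m s τ (j + 1)).const_mul _]
  simp_rw [integral_const_mul]
  have hτ' : (τ : ℝ) ≤ 1 / α := by rw [le_div_iff₀ hα]; linarith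
  have hg := gaussMoment_nonneg (j + 1)
  have h1 : ∀ m, ∫ ω, ‖β m (s + τ) ω - β m s ω‖ ^ (2 * (j + 1)) ∂P
      ≤ 2 ^ (j + 2) * gaussMoment (j + 1) * ((1 / α) ^ j * τ) := by
    intro m
    refine (hβ.integral_norm_pow_le m s τ (j + 1)).trans ?_
    -- One factor `τ` is kept to match the damping per step; the others are bounded by `1 / α`.
    rw [pow_succ (τ : ℝ)]
    gcongr
  calc A ^ j * ∑ m ∈ Finset.range N, η m * freq m ^ 2
          * ∫ ω, ‖β m (s + τ) ω - β m s ω‖ ^ (2 * (j + 1)) ∂P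
      ≤ A ^ j * ∑ m ∈ Finset.range N, η m * freq m ^ 2
          * (2 ^ (j + 2) * gaussMoment (j + 1) * ((1 / α) ^ j * τ)) := by
        refine mul_le_mul_of_nonneg_left (Finset.sum_le_sum fun m _ =>
          mul_le_mul_of_nonneg_left (h1 m) (ha m)) (by positivity)
    _ ≤ A ^ j * (A * (2 ^ (j + 2) * gaussMoment (j + 1) * ((1 / α) ^ j * τ))) := by
        rw [← Finset.sum_mul]
        have := hA N
        gcongr
    _ = _ := by rw [noiseMoment]; ring

/-- The polynomial of `‖∇δW‖²` that controls the growth of powers of the energy. -/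
def noisePoly (r : ℕ) (Y : ℝ) : ℝ := (Y + Y ^ 4) + (Y + Y ^ 4) ^ (r + 1)

lemma noisePoly_nonneg (r : ℕ) {Y : ℝ} (hY : 0 ≤ Y) : 0 ≤ noisePoly r Y := by
  unfold noisePoly; positivity

lemma noisePoly_le (r : ℕ) {Y : ℝ} (hY : 0 ≤ Y) :
    noisePoly r Y ≤ Y + Y ^ 4 + 2 ^ r * (Y ^ (r + 1) + Y ^ (4 * r + 3 + 1)) := by
  unfold noisePoly
  have := add_pow_le hY (pow_nonneg hY 4) (r + 1)
  rw [← pow_mul] at this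
  simpa [mul_add] using this

/-- The bound for the expectation of `noisePoly`. -/
def noiseConst (A α : ℝ) (r : ℕ) : ℝ :=
  noiseMoment A α 0 + noiseMoment A α 3
    + 2 ^ r * (noiseMoment A α r + noiseMoment A α (4 * r + 3))

lemma noiseConst_nonneg {A α : ℝ} (hA : 0 ≤ A) (hα : 0 < α) (r : ℕ) : 0 ≤ noiseConst A α r := by
  have : ∀ j, 0 ≤ noiseMoment A α j := fun j => by
    have := gaussMoment_nonneg (j + 1)
    unfold noiseMoment; positivity
  have h0 := this 0
  have h1 := this 3
  have h2 := this r
  have h3 := this (4 * r + 3)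
  unfold noiseConst
  positivity

lemma IsCylindricalWiener.noisePoly_bound (hβ : IsCylindricalWiener β ℱ P) (hη : ∀ m, 0 ≤ η m)
    {A α : ℝ} (hA : ∀ N, ∑ m ∈ Finset.range N, η m * freq m ^ 2 ≤ A) (hα : 0 < α) (N : ℕ)
    (s τ : ℝ≥0) (hτ : α * τ ≤ 1) (r : ℕ) :
    Integrable (fun ω => noisePoly r (gradSq (noiseIncr η β N s (s + τ) ω))) P ∧
      ∫ ω, noisePoly r (gradSq (noiseIncr η β N s (s + τ) ω)) ∂P ≤ noiseConst A α r * τ := by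
  obtain ⟨i1, b1⟩ := hβ.gradSq_pow hη hA hα N s τ hτ 0
  obtain ⟨i2, b2⟩ := hβ.gradSq_pow hη hA hα N s τ hτ 3
  obtain ⟨i3, b3⟩ := hβ.gradSq_pow hη hA hα N s τ hτ r
  obtain ⟨i4, b4⟩ := hβ.gradSq_pow hη hA hα N s τ hτ (4 * r + 3)
  simp only [zero_add, pow_one, Nat.reduceAdd] at i1 b1 i2 b2
  have i12 : Integrable (fun ω => gradSq (noiseIncr η β N s (s + τ) ω)
      + gradSq (noiseIncr η β N s (s + τ) ω) ^ 4) P := i1.add i2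
  have i34 : Integrable (fun ω => 2 ^ r * (gradSq (noiseIncr η β N s (s + τ) ω) ^ (r + 1)
      + gradSq (noiseIncr η β N s (s + τ) ω) ^ (4 * r + 3 + 1))) P := (i3.add i4).const_mul (2 ^ r)
  have hint := i12.add i34
  have hY := fun ω => gradSq_nonneg (noiseIncr η β N s (s + τ) ω)
  have hm := (measurable_gradSq_noiseIncr (β := β) hη N s (s + τ)).mono
      (hβ.incrAlg_le _ _) le_rfl
  have hI : Integrable (fun ω => noisePoly r (gradSq (noiseIncr η β N s (s + τ) ω))) P := by
    refine hint.mono' ?_ (Filter.Eventually.of_forall fun ω => ?_)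
    · unfold noisePoly
      exact ((hm.add (hm.pow_const 4)).add ((hm.add (hm.pow_const 4)).pow_const _)).aestronglyMeasurable
    · rw [Real.norm_of_nonneg (noisePoly_nonneg r (hY ω))]
      exact noisePoly_le r (hY ω)
  refine ⟨hI, (integral_mono hI hint fun ω => noisePoly_le r (hY ω)).trans ?_⟩
  simp only [Pi.add_apply]
  rw [integral_add i12 i34, integral_add i1 i2, integral_const_mul, integral_add i3 i4]
  have : (2 : ℝ) ^ r * (_ + _) ≤ 2 ^ r * (_ + _) :=
    mul_le_mul_of_nonneg_left (add_le_add b3 b4) (by positivity)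
  unfold noiseConst
  linarith

/-! ### Continuity in the coefficients -/

lemma continuous_coeff_sum (N : ℕ) {f : ℕ → ℝ → ℂ} (hf : ∀ m, Continuous (f m)) :
    Continuous (fun p : (ℕ → ℂ) × ℝ => ∑ m ∈ Finset.range N, p.1 m * f m p.2) :=
  continuous_finsetSum _ fun m _ =>
    ((continuous_apply m).comp continuous_fst).mul ((hf m).comp continuous_snd)

/-- Transfers adaptedness of the coordinates to the energy, as a measurable function of them. -/
lemma continuous_energy_sinSum (lam : ℝ) (N : ℕ) :
    Continuous (fun c : ℕ → ℂ => energy lam (sinSum N c)) := by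
  have h1 := continuous_coeff_sum N continuous_e
  have h2 := continuous_coeff_sum N continuous_eDeriv
  unfold energy
  simp_rw [deriv_sinSum]
  refine (intervalIntegral.continuous_parametric_intervalIntegral_of_continuous' ?_ 0 1).sub
    (continuous_const.mul
      (intervalIntegral.continuous_parametric_intervalIntegral_of_continuous' ?_ 0 1))
  · exact h2.norm.pow 2
  · exact h1.norm.pow 4

/-- The coefficient of the energy derivative at `w` in the direction of the `m`-th mode. -/
def energyDerivCoeff (l : ℝ) (w : ℝ → ℂ) (m : ℕ) : ℂ :=
  2 * ip (deriv w) (eDeriv m) + 2 * (l : ℂ) * ip (cubic w) (e m)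

lemma continuous_energyDerivCoeff (l : ℝ) (N m : ℕ) :
    Continuous (fun c : ℕ → ℂ => energyDerivCoeff l (sinSum N c) m) := by
  have h1 := continuous_coeff_sum N continuous_e
  have h2 := continuous_coeff_sum N continuous_eDeriv
  unfold energyDerivCoeff ip cubic
  simp_rw [deriv_sinSum]
  refine (continuous_const.mul
    (intervalIntegral.continuous_parametric_intervalIntegral_of_continuous' ?_ 0 1)).add
    (continuous_const.mul
      (intervalIntegral.continuous_parametric_intervalIntegral_of_continuous' ?_ 0 1))
  · exact h2.mul (Complex.continuous_conj.comp ((continuous_eDeriv m).comp continuous_snd))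
  · exact ((Complex.continuous_ofReal.comp (h1.norm.pow 2)).mul h1).mul
      (Complex.continuous_conj.comp ((continuous_e m).comp continuous_snd))

/-- Separates the increments `d` from coefficients depending on the past only, so that independence
can be applied mode by mode. -/
lemma energyDeriv_sinSum (l : ℝ) {N : ℕ} {w : ℝ → ℂ} (hw : w ∈ V N) (d : ℕ → ℂ) :
    energyDeriv l w (sinSum N d)
      = (∑ m ∈ Finset.range N, starRingEnd ℂ (d m) * energyDerivCoeff l w m).re := by
  have h : ∑ m ∈ Finset.range N, starRingEnd ℂ (d m) * energyDerivCoeff l w m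
      = ((2 : ℝ) : ℂ) * ip (deriv w) (deriv (sinSum N d))
        + ((2 * l : ℝ) : ℂ) * ip (cubic w) (sinSum N d) := by
    rw [deriv_sinSum]
    unfold sinSum
    rw [ip_sum_right _ _ _ continuous_eDeriv (continuous_deriv_of_mem_V hw),
      ip_sum_right _ _ _ continuous_e (continuous_cubic (continuous_of_mem_V hw)),
      Finset.mul_sum, Finset.mul_sum, ← Finset.sum_add_distrib]
    refine Finset.sum_congr rfl fun m _ => ?_
    rw [energyDerivCoeff]
    push_cast
    ring
  rw [h, Complex.add_re, Complex.re_ofReal_mul, Complex.re_ofReal_mul, energyDeriv]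

lemma norm_ip_le {f g : ℝ → ℂ} (hf : Continuous f) {B : ℝ} (hg : ∀ x, ‖g x‖ ≤ B) :
    ‖ip f g‖ ≤ (∫ x in (0 : ℝ)..1, ‖f x‖) * B := by
  unfold ip
  rw [← intervalIntegral.integral_mul_const]
  refine intervalIntegral.norm_integral_le_of_norm_le zero_le_one
    (Filter.Eventually.of_forall fun x _ => ?_)
    ((hf.norm.mul continuous_const).intervalIntegrable _ _)
  rw [norm_mul, RCLike.norm_conj]
  exact mul_le_mul_of_nonneg_left (hg x) (norm_nonneg _)

lemma norm_e_le (m : ℕ) (x : ℝ) : ‖e m x‖ ≤ 2 := by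
  unfold e
  rw [Complex.norm_real, Real.norm_eq_abs, abs_mul, abs_of_nonneg (Real.sqrt_nonneg 2)]
  have h1 := Real.abs_sin_le_one ((m + 1) * Real.pi * x)
  have h2 : √2 ≤ 2 := by rw [Real.sqrt_le_left (by norm_num)]; norm_num
  nlinarith [Real.sqrt_nonneg 2]

lemma norm_eDeriv_le (m : ℕ) (x : ℝ) : ‖eDeriv m x‖ ≤ 2 * freq m := by
  unfold eDeriv
  rw [Complex.norm_real, Real.norm_eq_abs, abs_mul, abs_mul, abs_of_nonneg (Real.sqrt_nonneg 2),
    abs_of_nonneg (freq_pos m).le]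
  have h1 := Real.abs_cos_le_one (freq m * x)
  have h2 : √2 ≤ 2 := by rw [Real.sqrt_le_left (by norm_num)]; norm_num
  exact mul_le_mul h2 (mul_le_of_le_one_right (freq_pos m).le h1)
    (mul_nonneg (freq_pos m).le (abs_nonneg _)) (by norm_num)

/-- A crude bound, used for integrability alone; its growth in `m` never enters the final constant.
-/
lemma norm_energyDerivCoeff_le {l : ℝ} (hl : l = 0 ∨ l = 1) {N : ℕ} {w : ℝ → ℂ} (hw : w ∈ V N)
    (m : ℕ) : ‖energyDerivCoeff l w m‖ ≤ (4 * freq m + 8) * (1 + energy (-l) w) := by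
  have hw' := continuous_of_mem_V hw
  have dw := continuous_deriv_of_mem_V hw
  have h1 := norm_ip_le dw (norm_eDeriv_le m)
  have h2 := norm_ip_le (continuous_cubic hw') (norm_e_le m)
  have h3 : ∫ x in (0 : ℝ)..1, ‖deriv w x‖ ≤ 1 + gradSq w := by
    have := integral_mono_unit (f := fun x => ‖deriv w x‖) (g := fun x => 1 + ‖deriv w x‖ ^ 2)
      (by fun_prop) (by fun_prop) fun x _ => by nlinarith [sq_nonneg (‖deriv w x‖ - 1)]
    rw [intervalIntegral.integral_add (Continuous.intervalIntegrable (by fun_prop) _ _)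
      (Continuous.intervalIntegrable (by fun_prop) _ _)] at this
    simpa [gradSq] using this
  have h4 : ∫ x in (0 : ℝ)..1, ‖cubic w x‖ ≤ 1 + quartic w := by
    have hc := continuous_cubic hw'
    have := integral_mono_unit (f := fun x => ‖cubic w x‖) (g := fun x => 1 + ‖w x‖ ^ 4)
      (by fun_prop) (by fun_prop) fun x _ => by
        have hn := norm_nonneg (w x)
        have : ‖cubic w x‖ = ‖w x‖ ^ 3 := by
          simp [cubic]; ring
        rw [this]
        nlinarith [sq_nonneg (‖w x‖ ^ 2 - ‖w x‖), sq_nonneg (‖w x‖ - 1), sq_nonneg (‖w x‖ ^ 2 - 1)]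
    rw [intervalIntegral.integral_add (Continuous.intervalIntegrable (by fun_prop) _ _)
      (Continuous.intervalIntegrable (by fun_prop) _ _)] at this
    simpa [quartic] using this
  have hg := gradSq_nonneg w
  have hq := quartic_nonneg w
  have hf := freq_pos m
  have h5 : ‖energyDerivCoeff l w m‖ ≤ 2 * ‖ip (deriv w) (eDeriv m)‖
      + 2 * l * ‖ip (cubic w) (e m)‖ := by
    unfold energyDerivCoeff
    refine (norm_add_le _ _).trans (le_of_eq ?_)
    have : |l| = l := abs_of_nonneg (by rcases hl with rfl | rfl <;> norm_num)
    simp [this]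
  rw [energy_neg]
  have h6 : ‖ip (deriv w) (eDeriv m)‖ ≤ (1 + gradSq w) * (2 * freq m) :=
    h1.trans (mul_le_mul_of_nonneg_right h3 (by positivity))
  rcases hl with rfl | rfl
  · nlinarith
  · nlinarith [mul_nonneg hf.le hq]

/-! ### One step in expectation -/

/-! ### Independence of the past and the increments -/

/-- The martingale term has vanishing expectation. -/
lemma IsCylindricalWiener.integral_mul_energyDeriv [IsProbabilityMeasure P]
    (hβ : IsCylindricalWiener β ℱ P) {l : ℝ}
    (hl : l = 0 ∨ l = 1) (N : ℕ) (s τ : ℝ≥0) {c : Ω → ℕ → ℂ} (hc : Measurable[ℱ s] c) (n : ℕ)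
    (hint : Integrable (fun ω => (1 + energy (-l) (sinSum N (c ω))) ^ (n + 1)) P) :
    Integrable (fun ω => (1 + energy (-l) (sinSum N (c ω))) ^ n *
        energyDeriv l (sinSum N (c ω)) (noiseIncr η β N s (s + τ) ω)) P ∧
      ∫ ω, (1 + energy (-l) (sinSum N (c ω))) ^ n *
        energyDeriv l (sinSum N (c ω)) (noiseIncr η β N s (s + τ) ω) ∂P = 0 := by
  have h0 : 0 ≤ l := by rcases hl with rfl | rfl <;> norm_num
  have hS : ∀ ω, 0 ≤ 1 + energy (-l) (sinSum N (c ω)) := fun ω => by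
    linarith [energy_neg_nonneg h0 (sinSum N (c ω))]
  let B : ℕ → Ω → ℂ := fun m ω => (((1 + energy (-l) (sinSum N (c ω))) ^ n : ℝ) : ℂ) *
    ((√(η m) : ℂ) * energyDerivCoeff l (sinSum N (c ω)) m)
  have hBm : ∀ m, Measurable[ℱ s] (B m) := fun m => by
    have hcont : Continuous (fun c : ℕ → ℂ => (((1 + energy (-l) (sinSum N c)) ^ n : ℝ) : ℂ) *
        ((√(η m) : ℂ) * energyDerivCoeff l (sinSum N c) m)) :=
      (Complex.continuous_ofReal.comp
        ((continuous_const.add (continuous_energy_sinSum (-l) N)).pow n)).mul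
        (continuous_const.mul (continuous_energyDerivCoeff l N m))
    exact hcont.measurable.comp hc
  have hBi : ∀ m, Integrable (B m) P := fun m => by
    refine (hint.const_mul (√(η m) * (4 * freq m + 8))).mono'
      ((hBm m).mono (ℱ.le s) le_rfl).aestronglyMeasurable (Filter.Eventually.of_forall fun ω => ?_)
    simp only [B, norm_mul, Complex.norm_real, Real.norm_eq_abs]
    rw [abs_of_nonneg (pow_nonneg (hS ω) n), abs_of_nonneg (Real.sqrt_nonneg _)]
    have h1 := norm_energyDerivCoeff_le hl (sinSum_mem_V N (c ω)) m
    have h2 := mul_le_mul_of_nonneg_left h1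
      (mul_nonneg (pow_nonneg (hS ω) n) (Real.sqrt_nonneg (η m)))
    rw [pow_succ]
    linarith
  have hDm : ∀ m, Measurable[incrAlg β s (s + τ)]
      (fun ω => starRingEnd ℂ (β m (s + τ) ω - β m s ω)) := fun m =>
    Complex.continuous_conj.measurable.comp (measurable_incrAlg β s (s + τ) m)
  have hDi : ∀ m, Integrable (fun ω => starRingEnd ℂ (β m (s + τ) ω - β m s ω)) P := fun m =>
    Complex.conjCLE.toContinuousLinearMap.integrable_comp (hβ.integrable_incr m s τ)
  have hind : ∀ m, IndepFun (fun ω => starRingEnd ℂ (β m (s + τ) ω - β m s ω)) (B m) P := fun m =>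
    hβ.indepFun le_self_add (hDm m) (hBm m)
  have hprod : ∀ m, Integrable (fun ω => starRingEnd ℂ (β m (s + τ) ω - β m s ω) * B m ω) P :=
    fun m => (hind m).integrable_mul (hDi m) (hBi m)
  have hzero : ∀ m, ∫ ω, starRingEnd ℂ (β m (s + τ) ω - β m s ω) * B m ω ∂P = 0 := fun m => by
    rw [(hind m).integral_fun_mul_eq_mul_integral (hDi m).aestronglyMeasurable
      (hBi m).aestronglyMeasurable, integral_conj, hβ.integral_incr, map_zero, zero_mul]
  have heq : ∀ ω, (1 + energy (-l) (sinSum N (c ω))) ^ n *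
        energyDeriv l (sinSum N (c ω)) (noiseIncr η β N s (s + τ) ω)
      = RCLike.re (∑ m ∈ Finset.range N, starRingEnd ℂ (β m (s + τ) ω - β m s ω) * B m ω) := by
    intro ω
    rw [noiseIncr_eq, energyDeriv_sinSum l (sinSum_mem_V N (c ω)), ← Complex.re_ofReal_mul,
      Finset.mul_sum, RCLike.re_eq_complex_re]
    congr 1
    refine Finset.sum_congr rfl fun m _ => ?_
    simp only [B, map_mul, Complex.conj_ofReal]
    ring
  have hsum := integrable_finsetSum (Finset.range N) fun m _ => hprod m
  simp_rw [heq]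
  refine ⟨hsum.re, ?_⟩
  rw [integral_re hsum, integral_finsetSum _ fun m _ => hprod m,
    Finset.sum_eq_zero fun m _ => hzero m, map_zero]

/-- The growth of a power of the energy in one step, in expectation. -/
lemma IsCylindricalWiener.integral_step_le [IsProbabilityMeasure P]
    (hβ : IsCylindricalWiener β ℱ P) (hη : ∀ m, 0 ≤ η m)
    {A α : ℝ} (hA : ∀ N, ∑ m ∈ Finset.range N, η m * freq m ^ 2 ≤ A) (hα : 0 < α) {l : ℝ}
    (hl : l = 0 ∨ l = 1) (N : ℕ) (s τ : ℝ≥0) (hτ : α * τ ≤ 1) (r : ℕ) {c d : Ω → ℕ → ℂ}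
    (hc : Measurable[ℱ s] c) (hd : Measurable d) {t : ℝ}
    (hint : Integrable (fun ω => (1 + energy (-l) (sinSum N (c ω))) ^ (2 * r + 2)) P)
    (hstep : ∀ᵐ ω ∂P, DampedStep (-l) t N (sinSum N (c ω)) (sinSum N (d ω))
      (noiseIncr η β N s (s + τ) ω)) {ε : ℝ} (hε : 0 < ε) :
    Integrable (fun ω => (1 + energy (-l) (sinSum N (d ω))) ^ (2 * r + 2)) P ∧
      ∫ ω, (1 + energy (-l) (sinSum N (d ω))) ^ (2 * r + 2) ∂P
        ≤ ∫ ω, (1 + energy (-l) (sinSum N (c ω))) ^ (2 * r + 2) ∂P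
          + stepConst r * ((ε * ∫ ω, (1 + energy (-l) (sinSum N (c ω))) ^ (2 * r + 2) ∂P
            + (1 / ε) ^ (4 * r + 3)) * (noiseConst A α r * τ)) := by
  have h0 : 0 ≤ l := by rcases hl with rfl | rfl <;> norm_num
  have hE : ∀ v, 0 ≤ energy (-l) v := energy_neg_nonneg h0
  obtain ⟨iM, eM⟩ := hβ.integral_mul_energyDeriv (η := η) hl N s τ hc (2 * r + 1) hint
  obtain ⟨iZ, bZ⟩ := hβ.noisePoly_bound hη hA hα N s τ hτ r
  have hcont : Continuous (fun c : ℕ → ℂ => √(1 + energy (-l) (sinSum N c)) ^ (4 * r + 3)) :=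
    (continuous_const.add (continuous_energy_sinSum (-l) N)).sqrt.pow _
  have hQm : Measurable[ℱ s] (fun ω => √(1 + energy (-l) (sinSum N (c ω))) ^ (4 * r + 3)) :=
    hcont.measurable.comp hc
  have hQle : ∀ ω, √(1 + energy (-l) (sinSum N (c ω))) ^ (4 * r + 3)
      ≤ ε * (1 + energy (-l) (sinSum N (c ω))) ^ (2 * r + 2) + (1 / ε) ^ (4 * r + 3) := fun ω => by
    -- The next power of the square root, `4r + 4`, is exactly the moment under study.
    have h1 := pow_le_eps (Real.sqrt_nonneg (1 + energy (-l) (sinSum N (c ω)))) hε (4 * r + 3)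
    rwa [show 4 * r + 3 + 1 = 2 * (2 * r + 2) by ring, pow_mul,
      Real.sq_sqrt (by linarith [hE (sinSum N (c ω))])] at h1
  have iQ' := (hint.const_mul ε).add (integrable_const ((1 / ε) ^ (4 * r + 3)))
  have iQ : Integrable (fun ω => √(1 + energy (-l) (sinSum N (c ω))) ^ (4 * r + 3)) P := by
    refine iQ'.mono' (hQm.mono (ℱ.le s) le_rfl).aestronglyMeasurable
      (Filter.Eventually.of_forall fun ω => ?_)
    rw [Real.norm_of_nonneg (by positivity)]
    exact hQle ω
  have bQ : ∫ ω, √(1 + energy (-l) (sinSum N (c ω))) ^ (4 * r + 3) ∂P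
      ≤ ε * ∫ ω, (1 + energy (-l) (sinSum N (c ω))) ^ (2 * r + 2) ∂P + (1 / ε) ^ (4 * r + 3) := by
    refine (integral_mono iQ iQ' hQle).trans (le_of_eq ?_)
    simp only [Pi.add_apply]
    rw [integral_add (hint.const_mul ε) (integrable_const _), integral_const_mul]
    simp
  have hZm : Measurable[incrAlg β s (s + τ)]
      (fun ω => noisePoly r (gradSq (noiseIncr η β N s (s + τ) ω))) := by
    have h : Measurable (noisePoly r) := by
      have : Continuous (noisePoly r) := by unfold noisePoly; fun_prop
      exact this.measurable
    exact h.comp (measurable_gradSq_noiseIncr hη N s (s + τ))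
  -- The energy factor depends on the past, the noise polynomial on the increment: the expectation
  -- factorises, so no higher energy moment is needed.
  have hind := (hβ.indepFun le_self_add hZm hQm).symm
  have iQZ : Integrable (fun ω => √(1 + energy (-l) (sinSum N (c ω))) ^ (4 * r + 3)
      * noisePoly r (gradSq (noiseIncr η β N s (s + τ) ω))) P := hind.integrable_mul iQ iZ
  have eQZ := hind.integral_fun_mul_eq_mul_integral iQ.aestronglyMeasurable iZ.aestronglyMeasurable
  have iMaj := (hint.add (iM.const_mul (2 * (r : ℝ) + 2))).add (iQZ.const_mul (stepConst r))
  have hle : ∀ᵐ ω ∂P, (1 + energy (-l) (sinSum N (d ω))) ^ (2 * r + 2)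
      ≤ (1 + energy (-l) (sinSum N (c ω))) ^ (2 * r + 2)
        + (2 * r + 2) * ((1 + energy (-l) (sinSum N (c ω))) ^ (2 * r + 1)
          * energyDeriv l (sinSum N (c ω)) (noiseIncr η β N s (s + τ) ω))
        + stepConst r * (√(1 + energy (-l) (sinSum N (c ω))) ^ (4 * r + 3) *
          noisePoly r (gradSq (noiseIncr η β N s (s + τ) ω))) := by
    filter_upwards [hstep] with ω hω
    exact hω.one_add_energy_pow_le hl (sinSum_mem_V _ _) (sinSum_mem_V _ _) (sinSum_mem_V _ _) r
  have hdm : Measurable (fun ω => (1 + energy (-l) (sinSum N (d ω))) ^ (2 * r + 2)) :=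
    ((continuous_const.add (continuous_energy_sinSum (-l) N)).pow _).measurable.comp hd
  have iU : Integrable (fun ω => (1 + energy (-l) (sinSum N (d ω))) ^ (2 * r + 2)) P := by
    refine iMaj.mono' hdm.aestronglyMeasurable ?_
    filter_upwards [hle] with ω hω
    rw [Real.norm_of_nonneg (pow_nonneg (by linarith [hE (sinSum N (d ω))]) _)]
    exact hω
  refine ⟨iU, (integral_mono_ae iU iMaj hle).trans ?_⟩
  have e1 := integral_add (hint.add (iM.const_mul (2 * (r : ℝ) + 2))) (iQZ.const_mul (stepConst r))
  have e2 := integral_add hint (iM.const_mul (2 * (r : ℝ) + 2))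
  rw [integral_const_mul, eM, mul_zero, add_zero] at e2
  rw [integral_const_mul, eQZ] at e1
  refine (le_of_eq e1).trans ((add_le_add_left (le_of_eq e2) _).trans ?_)
  have hZ0 : 0 ≤ ∫ ω, noisePoly r (gradSq (noiseIncr η β N s (s + τ) ω)) ∂P :=
    integral_nonneg fun ω => noisePoly_nonneg r (gradSq_nonneg _)
  have hy0 : 0 ≤ ∫ ω, (1 + energy (-l) (sinSum N (c ω))) ^ (2 * r + 2) ∂P :=
    integral_nonneg fun ω => pow_nonneg (by linarith [hE (sinSum N (c ω))]) _
  have := mul_le_mul bQ bZ hZ0 (by positivity)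
  have := mul_le_mul_of_nonneg_left this (stepConst_pos r).le
  linarith

/-! ### The noise and the initial value -/

lemma freq_sq_le_norm_eigA {α : ℝ} (n : ℕ) : freq n ^ 2 ≤ ‖eigA α n‖ := by
  have h : (eigA α n).im = freq n ^ 2 := by
    have : eigA α n = Complex.I * ((freq n ^ 2 : ℝ) : ℂ) + (α : ℂ) := by
      simp [eigA, freq]
    rw [this]
    simp [-Complex.ofReal_pow]
  rw [← h]
  exact (le_abs_self _).trans (Complex.abs_im_le_norm _)

lemma sqrtQ_e (η : ℕ → ℝ) (m : ℕ) : sqrtQ η (e m) = fun x => (√(η m) : ℂ) * e m x := by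
  ext x
  unfold sqrtQ
  rw [tsum_eq_single m]
  · simp [ip_e]
  · intro n hn
    simp [ip_e, hn.symm]

lemma ofReal_le_sobNormSq_sqrtQ {α : ℝ} {η : ℕ → ℝ} (hη : ∀ m, 0 ≤ η m) (m : ℕ) :
    ENNReal.ofReal (η m * freq m ^ 2) ≤ sobNormSq α 1 (sqrtQ η (e m)) := by
  refine le_trans ?_ (ENNReal.le_tsum m)
  have h : ip (fun x => (√(η m) : ℂ) * e m x) (e m) = √(η m) := by
    have h1 := ip_e m m
    unfold ip at h1 ⊢
    simp_rw [mul_assoc]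
    rw [intervalIntegral.integral_const_mul, h1]
    simp
  rw [sqrtQ_e, h, Complex.norm_real, Real.norm_eq_abs, sq_abs, Real.sq_sqrt (hη m), pow_one]
  exact ENNReal.ofReal_le_ofReal (mul_le_mul_of_nonneg_left (freq_sq_le_norm_eigA m) (hη m))

/-- Supplies the `N`-independent constant `A` of the noise moments, using that the imaginary part of
the eigenvalue is `freq m ^ 2`. -/
lemma sum_le_hsNormSq {α : ℝ} {η : ℕ → ℝ} (hη : ∀ m, 0 ≤ η m) (hQ : hsNormSq α 1 η < ∞) (N : ℕ) :
    ∑ m ∈ Finset.range N, η m * freq m ^ 2 ≤ (hsNormSq α 1 η).toReal := by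
  rw [← ENNReal.ofReal_le_iff_le_toReal hQ.ne, ENNReal.ofReal_sum_of_nonneg
    fun m _ => mul_nonneg (hη m) (sq_nonneg _)]
  exact (Finset.sum_le_sum fun m _ => ofReal_le_sobNormSq_sqrtQ hη m).trans (ENNReal.sum_le_tsum _)

lemma gradSq_proj_le {α : ℝ} {u₀ : ℝ → ℂ} (h : sobNormSq α 1 u₀ < ∞) (N : ℕ) :
    gradSq (proj N u₀) ≤ (sobNormSq α 1 u₀).toReal := by
  have h1 : gradSq (proj N u₀) = ∑ m ∈ Finset.range N, freq m ^ 2 * ‖ip u₀ (e m)‖ ^ 2 :=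
    integral_norm_deriv_sinSum_sq N fun m => ip u₀ (e m)
  rw [h1, ← ENNReal.ofReal_le_iff_le_toReal h.ne, ENNReal.ofReal_sum_of_nonneg
    fun m _ => by positivity]
  refine (Finset.sum_le_sum fun m _ => ?_).trans (ENNReal.sum_le_tsum (Finset.range N))
  refine ENNReal.ofReal_le_ofReal ?_
  rw [pow_one, mul_comm]
  exact mul_le_mul_of_nonneg_left (freq_sq_le_norm_eigA m) (by positivity)

lemma energy_proj_le {α l : ℝ} (hl1 : l ≤ 1) {u₀ : ℝ → ℂ}
    (h : sobNormSq α 1 u₀ < ∞) (N : ℕ) :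
    energy (-l) (proj N u₀) ≤ (sobNormSq α 1 u₀).toReal + (sobNormSq α 1 u₀).toReal ^ 2 := by
  have h1 := gradSq_proj_le h N
  have h2 := quartic_le_gradSq (proj_mem_V N u₀)
  have h3 := pow_le_pow_left₀ (gradSq_nonneg _) h1 2
  have h4 : l / 2 * quartic (proj N u₀) ≤ 1 * quartic (proj N u₀) :=
    mul_le_mul_of_nonneg_right (by linarith) (quartic_nonneg _)
  rw [energy_neg]
  linarith

/-! ### The uniform bound -/

variable {α l : ℝ} {u₀ : ℝ → ℂ} {τ : ℝ≥0}
  {N : ℕ} {u : ℕ → Ω → ℝ → ℂ}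

lemma IsSchemeSolution.measurable_coeff (hu : IsSchemeSolution α l η u₀ τ N β ℱ P u) (k : ℕ) :
    Measurable[ℱ (k * τ)] (fun ω (m : ℕ) => ip (u k ω) (e m)) := by
  exact @measurable_pi_lambda _ _ _ (ℱ (k * τ)) _ _ fun m => hu.adapted k m

/-- The exponent-dependent size of the forcing relative to the damping. -/
def forcing (α A : ℝ) (r : ℕ) : ℝ :=
  2 * (stepConst r * (noiseConst A α r + 1)) / α *
    (4 * (stepConst r * (noiseConst A α r + 1)) / α) ^ (4 * r + 3)

/-- Since `(1 + θ/2)(1 - θ) ≤ 1 - θ/2` and `(1 + θ/2)θ ≤ 2θ`, the recursion is `y₁ ≤ (1 - θ/2) y +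
θ(2 + G)`. The threshold `2(2 + G)` is its fixed point and no longer involves `θ`. -/
lemma contraction_le {y y₁ θ G B : ℝ} (hθ0 : 0 ≤ θ) (hθ : θ ≤ 1) (hB : 2 * (2 + G) ≤ B)
    (hy : y ≤ B) (hy0 : 0 ≤ y)
    (h : y₁ ≤ (1 + θ / 2) * ((1 - θ) * y + θ) + θ * G) : y₁ ≤ B := by
  have h1 : (1 + θ / 2) * (1 - θ) * y ≤ (1 - θ / 2) * y :=
    mul_le_mul_of_nonneg_right (by nlinarith) hy0
  have h2 : (1 - θ / 2) * y ≤ (1 - θ / 2) * B := mul_le_mul_of_nonneg_left hy (by linarith)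
  have h3 : θ * (2 * (2 + G)) ≤ θ * B := mul_le_mul_of_nonneg_left hB hθ0
  nlinarith

lemma IsSchemeSolution.integral_energy_succ_le [IsProbabilityMeasure P]
    (hβ : IsCylindricalWiener β ℱ P) (hη : ∀ m, 0 ≤ η m) {A : ℝ}
    (hA : ∀ N, ∑ m ∈ Finset.range N, η m * freq m ^ 2 ≤ A) (hα : 0 < α) (hl : l = 0 ∨ l = 1)
    (hτ : α * τ ≤ 1) (hu : IsSchemeSolution α (-l) η u₀ τ N β ℱ P u) (r k : ℕ) {B : ℝ}
    (hB : 2 * (2 + forcing α A r) ≤ B)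
    (hint : Integrable (fun ω => (1 + energy (-l) (u k ω)) ^ (2 * r + 2)) P)
    (hle : ∫ ω, (1 + energy (-l) (u k ω)) ^ (2 * r + 2) ∂P ≤ B) :
    Integrable (fun ω => (1 + energy (-l) (u (k + 1) ω)) ^ (2 * r + 2)) P ∧
      ∫ ω, (1 + energy (-l) (u (k + 1) ω)) ^ (2 * r + 2) ∂P ≤ B := by
  have h0 : 0 ≤ l := by rcases hl with rfl | rfl <;> norm_num
  have hE : ∀ v, 0 ≤ energy (-l) v := energy_neg_nonneg h0
  have hA0 : 0 ≤ A := by simpa using hA 0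
  have hατ : 0 ≤ α * τ := by positivity
  set a : ℝ := Real.exp (-α * τ) with ha
  set θ : ℝ := α * τ / 2 with hθ
  have haθ : a ≤ 1 - θ := by
    have := exp_neg_le hατ hτ
    rwa [← neg_mul] at this
  have ha0 : 0 ≤ a := (Real.exp_pos _).le
  let c : Ω → ℕ → ℂ := fun ω m => (a : ℂ) * ip (u k ω) (e m)
  let d : Ω → ℕ → ℂ := fun ω m => ip (u (k + 1) ω) (e m)
  have hc : Measurable[ℱ (k * τ)] c :=
    @measurable_pi_lambda _ _ _ (ℱ (k * τ)) _ _ fun m =>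
      (continuous_const_mul (a : ℂ)).measurable.comp (hu.adapted k m)
  have hd : Measurable d := (hu.measurable_coeff (k + 1)).mono (ℱ.le _) le_rfl
  have hcw : ∀ ω, sinSum N (c ω) = fun x => (a : ℂ) * u k ω x := fun ω => by
    conv_rhs => rw [← sinSum_ip (hu.mem k ω)]
    ext x
    simp only [sinSum, c, Finset.mul_sum, mul_assoc]
  have hdu : ∀ ω, sinSum N (d ω) = u (k + 1) ω := fun ω => sinSum_ip (hu.mem (k + 1) ω)
  have hSle : ∀ ω, (1 + energy (-l) (sinSum N (c ω))) ^ (2 * r + 2)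
      ≤ (1 - θ) * (1 + energy (-l) (u k ω)) ^ (2 * r + 2) + θ := fun ω => by
    refine one_add_mul_pow_le (hE _) (by positivity) (by linarith) (hE _) ?_ _
    rw [hcw]
    exact (energy_smul_le h0 ha0 (by linarith [show 0 ≤ θ by positivity]) (hu.mem k ω)).trans
      (mul_le_mul_of_nonneg_right haθ (hE _))
  have iS' := (hint.const_mul (1 - θ)).add (integrable_const θ)
  have hSm : Measurable (fun ω => (1 + energy (-l) (sinSum N (c ω))) ^ (2 * r + 2)) :=
    ((continuous_const.add (continuous_energy_sinSum (-l) N)).pow _).measurable.comp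
      (hc.mono (ℱ.le _) le_rfl)
  have iS : Integrable (fun ω => (1 + energy (-l) (sinSum N (c ω))) ^ (2 * r + 2)) P := by
    refine iS'.mono' hSm.aestronglyMeasurable (Filter.Eventually.of_forall fun ω => ?_)
    rw [Real.norm_of_nonneg (pow_nonneg (by linarith [hE (sinSum N (c ω))]) _)]
    exact hSle ω
  have bS : ∫ ω, (1 + energy (-l) (sinSum N (c ω))) ^ (2 * r + 2) ∂P
      ≤ (1 - θ) * ∫ ω, (1 + energy (-l) (u k ω)) ^ (2 * r + 2) ∂P + θ := by
    refine (integral_mono iS iS' hSle).trans (le_of_eq ?_)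
    simp only [Pi.add_apply]
    rw [integral_add (hint.const_mul _) (integrable_const _), integral_const_mul]
    simp
  have hstep : ∀ᵐ ω ∂P, DampedStep (-l) τ N (sinSum N (c ω)) (sinSum N (d ω))
      (noiseIncr η β N (k * τ) (k * τ + τ) ω) := by
    filter_upwards [hu.step k] with ω hω
    rw [hcw, hdu]
    rw [show ((k : ℝ≥0) + 1) * τ = k * τ + τ by ring] at hω
    -- `SchemeStep` with previous value `v` unfolds to `DampedStep` with previous value `a * v`.
    exact hω
  have hK := noiseConst_nonneg hA0 hα r
  have hs := stepConst_pos r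
  -- The added 1 keeps `K` positive even when the noise vanishes. With `ε = α / (4K)` the growth `K
  -- τ ε` is `ατ/4 = θ/2`, half of the damping.
  set K := stepConst r * (noiseConst A α r + 1) with hKd
  have hK0 : 0 < K := by positivity
  have hε : 0 < α / (4 * K) := by positivity
  obtain ⟨iU, bU⟩ := hβ.integral_step_le hη hA hα hl N (k * τ) τ hτ r hc hd iS hstep hε
  simp_rw [hdu] at iU bU
  refine ⟨iU, ?_⟩
  have hy0 : 0 ≤ ∫ ω, (1 + energy (-l) (u k ω)) ^ (2 * r + 2) ∂P :=
    integral_nonneg fun ω => pow_nonneg (by linarith [hE (u k ω)]) _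
  have hS0 : 0 ≤ ∫ ω, (1 + energy (-l) (sinSum N (c ω))) ^ (2 * r + 2) ∂P :=
    integral_nonneg fun ω => pow_nonneg (by linarith [hE (sinSum N (c ω))]) _
  refine contraction_le (θ := θ) (by positivity) (by linarith) hB hle hy0 (bU.trans ?_)
  generalize ∫ ω, (1 + energy (-l) (sinSum N (c ω))) ^ (2 * r + 2) ∂P = S at *
  have h1 : stepConst r * ((α / (4 * K) * S + (1 / (α / (4 * K))) ^ (4 * r + 3))
        * (noiseConst A α r * τ))
      ≤ K * τ * (α / (4 * K) * S + (1 / (α / (4 * K))) ^ (4 * r + 3)) := by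
    have hb : 0 ≤ α / (4 * K) * S + (1 / (α / (4 * K))) ^ (4 * r + 3) := by positivity
    have : stepConst r * noiseConst A α r * τ ≤ K * τ := by
      refine mul_le_mul_of_nonneg_right ?_ τ.coe_nonneg
      rw [hKd]; linarith
    nlinarith [mul_le_mul_of_nonneg_right this hb]
  have h2 : K * τ * (α / (4 * K) * S + (1 / (α / (4 * K))) ^ (4 * r + 3))
      = θ / 2 * S + θ * forcing α A r := by
    rw [forcing, ← hKd, one_div_div, hθ]
    field_simp
    ring
  have h3 : (1 + θ / 2) * S
      ≤ (1 + θ / 2) * ((1 - θ) * ∫ ω, (1 + energy (-l) (u k ω)) ^ (2 * r + 2) ∂P + θ) :=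
    mul_le_mul_of_nonneg_left bS (by positivity)
  linarith

lemma IsSchemeSolution.integral_energy_le [IsProbabilityMeasure P]
    (hβ : IsCylindricalWiener β ℱ P) (hη : ∀ m, 0 ≤ η m) {A : ℝ}
    (hA : ∀ N, ∑ m ∈ Finset.range N, η m * freq m ^ 2 ≤ A) (hα : 0 < α) (hl : l = 0 ∨ l = 1)
    (hu₀ : sobNormSq α 1 u₀ < ∞)
    (hτ : α * τ ≤ 1) (hu : IsSchemeSolution α (-l) η u₀ τ N β ℱ P u) (r k : ℕ) {B : ℝ}
    (hB : 2 * (2 + forcing α A r) ≤ B)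
    (hB₀ : (1 + ((sobNormSq α 1 u₀).toReal + (sobNormSq α 1 u₀).toReal ^ 2)) ^ (2 * r + 2) ≤ B) :
    Integrable (fun ω => (1 + energy (-l) (u k ω)) ^ (2 * r + 2)) P ∧
      ∫ ω, (1 + energy (-l) (u k ω)) ^ (2 * r + 2) ∂P ≤ B := by
  have h0 : 0 ≤ l := by rcases hl with rfl | rfl <;> norm_num
  have h1 : l ≤ 1 := by rcases hl with rfl | rfl <;> norm_num
  induction k with
  | zero =>
    have h : (fun _ => (1 + energy (-l) (proj N u₀)) ^ (2 * r + 2))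
        =ᵐ[P] fun ω => (1 + energy (-l) (u 0 ω)) ^ (2 * r + 2) := by
      filter_upwards [hu.init] with ω hω
      rw [hω]
    refine ⟨(integrable_const _).congr h, ?_⟩
    rw [← integral_congr_ae h]
    simp only [integral_const, probReal_univ, one_smul]
    refine le_trans (pow_le_pow_left₀ (by linarith [energy_neg_nonneg h0 (proj N u₀)]) ?_ _) hB₀
    linarith [energy_proj_le h1 hu₀ N]
  | succ k ih => exact hu.integral_energy_succ_le hβ hη hA hα hl hτ r k hB ih.1 ih.2

lemma rpow_le_one_add_pow {x p : ℝ} (hx : 0 ≤ x) {n : ℕ} (hp : 0 ≤ p) (hpn : p ≤ n) :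
    x ^ p ≤ (1 + x) ^ n := by
  rw [← Real.rpow_natCast]
  exact (Real.rpow_le_rpow hx (by linarith) hp).trans
    (Real.rpow_le_rpow_of_exponent_le (by linarith) hpn)

end

end DampedNLS

open DampedNLS in
theorem mainTheorem9 (α : ℝ) (hα : 0 < α)
    (η : ℕ → ℝ) (hη : ∀ m, 0 ≤ η m) (hηs : Summable η) (hQ : DampedNLS.hsNormSq α 1 η < ∞)
    (u₀ : ℝ → ℂ) (hu₀ : DampedNLS.MemH α 1 u₀) (p : ℝ) (hp : 1 ≤ p) :
    ∃ C : ℝ, ∀ (lam : ℝ), lam = 0 ∨ lam = -1 →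
      ∀ (τ : ℝ≥0), 0 < τ → α * τ ≤ 1 →
      ∀ (N : ℕ) (Ω : Type*) (mΩ : MeasurableSpace Ω) (P : Measure Ω) (_ : IsProbabilityMeasure P)
        (ℱ : Filtration ℝ≥0 mΩ) (β : ℕ → ℝ≥0 → Ω → ℂ) (_ : DampedNLS.IsCylindricalWiener β ℱ P)
        (u : ℕ → Ω → ℝ → ℂ)
        (_ : DampedNLS.IsSchemeSolution α lam η u₀ τ N β ℱ P u) (k : ℕ),
        Integrable (fun ω ↦ DampedNLS.energy lam (u k ω) ^ p) P ∧
          ∫ ω, DampedNLS.energy lam (u k ω) ^ p ∂P ≤ C := by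
  -- Moments are bounded for the even exponents `2r + 2`; a real `p` below such an exponent follows
  -- because `1 + H ≥ 1`.
  obtain ⟨r, hr⟩ := exists_nat_ge p
  have hpr : p ≤ ((2 * r + 2 : ℕ) : ℝ) := by
    push_cast
    have : (0 : ℝ) ≤ r := r.cast_nonneg
    linarith
  -- The first entry is the threshold preserved by each step, the second bounds the initial moment
  -- uniformly in `N`; both serve either value of `lam`.
  refine ⟨max (2 * (2 + forcing α (hsNormSq α 1 η).toReal r))
    ((1 + ((sobNormSq α 1 u₀).toReal + (sobNormSq α 1 u₀).toReal ^ 2)) ^ (2 * r + 2)), ?_⟩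
  intro lam hlam τ _ hτ N Ω mΩ P _ ℱ β hβ u hu k
  obtain ⟨l, hl, rfl⟩ : ∃ l : ℝ, (l = 0 ∨ l = 1) ∧ lam = -l :=
    ⟨-lam, hlam.imp (by simp [·]) (by simp [·]), by simp⟩
  have h0 : 0 ≤ l := by rcases hl with rfl | rfl <;> norm_num
  obtain ⟨hint, hle⟩ := hu.integral_energy_le hβ hη (sum_le_hsNormSq hη hQ) hα hl hu₀.2 hτ r k
    (le_max_left _ _) (le_max_right _ _)
  have hbound : ∀ ω, energy (-l) (u k ω) ^ p ≤ (1 + energy (-l) (u k ω)) ^ (2 * r + 2) := fun ω =>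
    rpow_le_one_add_pow (energy_neg_nonneg h0 _) (by linarith) hpr
  have hm : Measurable (fun ω => energy (-l) (u k ω)) := by
    have h := (continuous_energy_sinSum (-l) N).measurable.comp
      ((hu.measurable_coeff k).mono (ℱ.le _) le_rfl)
    have he : (fun ω => energy (-l) (u k ω)) = (fun c : ℕ → ℂ => energy (-l) (sinSum N c)) ∘
        fun ω (m : ℕ) => ip (u k ω) (e m) := by
      ext ω
      simp only [Function.comp, sinSum_ip (hu.mem k ω)]
    rw [he]
    exact h
  have hi : Integrable (fun ω => energy (-l) (u k ω) ^ p) P := by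
    refine hint.mono' (hm.pow_const p).aestronglyMeasurable (Filter.Eventually.of_forall fun ω => ?_)
    rw [Real.norm_of_nonneg (Real.rpow_nonneg (energy_neg_nonneg h0 _) p)]
    exact hbound ω
  exact ⟨hi, (integral_mono hi hint hbound).trans hle⟩
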